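/- Let $\Phi$ be a commutative unital ring, $G$ an abelian group, and $A=\bigoplus_{\sigma\in G}A_\sigma$ a $G$-graded associative (not necessarily unital) $\Phi$-algebra that is semiprime, i.e. has no nonzero two-sided ideal of square zero. Let $Q_s(A)$ be the symmetric Martindale algebra of quotients of $A$, and let $Q=\bigoplus_{\sigma\in G}Q_\sigma$ be a $G$-graded $\Phi$-algebra that is a subalgebra of $Q_s(A)$ containing $A$, with $A_\sigma\subseteq Q_\sigma$ for all $\sigma$. For an associative algebra $B$ let $B^-$ be the Lie algebra $B$ with $[x,y]=xy-yx$, let $[B,B]$ be the Lie ideal of $B^-$ spanned by the brackets, and for a Lie algebra $L$ let $Z_L=\{x\in L : [x,L]=0\}$ ($Z_B:=Z_{B^-}$). If $B$ is $G$-graded, then $B^-$, $[B,B]$ and their quotients by their centers carry the induced $G$-gradings. Let $M=\bigoplus M_\sigma$ be a $G$-graded Lie algebra and $L=\bigoplus L_\sigma$ a graded subalgebra. $M$ is a *graded algebra of quotients* of $L$ if for all $\sigma,\tau\in G$, $0\ne p\in M_\sigma$ and $q\in M_\tau$ there are $\alpha\in G$ and $x\in L_\alpha$ with $[x,p]\neq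 0$ and $[x,{}_L(q)]\subseteq L$, where ${}_L(q)$ is the linear span in $M$ of $q$ and all elements $\mathrm{ad}_{x_1}\cdots\mathrm{ad}_{x_n}q$ with $n\in\mathbb N$, $x_1,\dots,x_n\in L$. Then: (i) the inclusion $A\subseteq Q$ induces a graded Lie algebra monomorphism $A^- /Z_A\to Q^- /Z_Q$, and via it $Q^- /Z_Q$ is a graded algebra of quotients of $A^- /Z_A$; (ii) if moreover $A$ is 2-torsion free ($2a=0$ implies $a=0$ for $a\in A$), then the inclusion induces a graded Lie algebra monomorphism $[A,A]/Z_{[A,A]}\to [Q,Q]/Z_{[Q,Q]}$, and via it $[Q,Q]/Z_{[Q,Q]}$ is a graded algebra of quotients of $[A,A]/Z_{[A,A]}$. -/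

import Mathlib

/-! ### Semiprime associative algebras and their symmetric Martindale algebra of quotients -/

section Associative

variable (Φ : Type*) [CommRing Φ] (A : Type*) [NonUnitalRing A] [Module Φ A]

variable {Φ A} in
/-- A `Φ`-submodule of the (not necessarily unital) associative algebra `A` that is a two-sided
ideal. -/
structure IsTwoSidedIdeal (I : Submodule Φ A) : Prop where
  mul_mem_left : ∀ (a : A) {x : A}, x ∈ I → a * x ∈ I
  mul_mem_right : ∀ (a : A) {x : A}, x ∈ I → x * a ∈ I

/-- `A` is semiprime: it has no nonzero two-sided ideal of square zero. -/
class SemiprimeAlgebra : Prop where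
  eq_bot_of_sq_eq_zero : ∀ I : Submodule Φ A, IsTwoSidedIdeal I →
    (∀ x ∈ I, ∀ y ∈ I, x * y = 0) → I = ⊥

variable {Φ A} in
/-- A two-sided ideal with zero left and right annihilators in `A`. For a semiprime algebra these
are exactly the essential two-sided ideals. -/
structure IsDenseIdeal (I : Submodule Φ A) : Prop extends IsTwoSidedIdeal I where
  eq_zero_of_mul_left : ∀ z : A, (∀ x ∈ I, z * x = 0) → z = 0
  eq_zero_of_mul_right : ∀ z : A, (∀ x ∈ I, x * z = 0) → z = 0

/-- A compatible pair of partial multipliers: a homomorphism of right `A`-modules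
`left : dom → A` (`x ↦ q x`) and a homomorphism of left `A`-modules `right : dom → A` (`x ↦ x q`),
defined on a dense two-sided ideal `dom`, with `x (q y) = (x q) y`. -/
structure PartialMultiplier where
  dom : Submodule Φ A
  dense : IsDenseIdeal dom
  left : dom →ₗ[Φ] A
  right : dom →ₗ[Φ] A
  left_mul : ∀ (x : dom) (a : A), left ⟨x * a, dense.mul_mem_right a x.2⟩ = left x * a
  right_mul : ∀ (a : A) (x : dom), right ⟨a * x, dense.mul_mem_left a x.2⟩ = a * right x
  balanced : ∀ x y : dom, (x : A) * left y = right x * (y : A)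

variable {Φ A}

theorem IsDenseIdeal.inf {I J : Submodule Φ A} (hI : IsDenseIdeal I) (hJ : IsDenseIdeal J) :
    IsDenseIdeal (I ⊓ J) where
  mul_mem_left a _ hx := ⟨hI.mul_mem_left a hx.1, hJ.mul_mem_left a hx.2⟩
  mul_mem_right a _ hx := ⟨hI.mul_mem_right a hx.1, hJ.mul_mem_right a hx.2⟩
  eq_zero_of_mul_left z hz := by
    refine hI.eq_zero_of_mul_left z fun x hx => hJ.eq_zero_of_mul_left _ fun y hy => ?_
    rw [mul_assoc]
    exact hz _ ⟨hI.mul_mem_right y hx, hJ.mul_mem_left x hy⟩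
  eq_zero_of_mul_right z hz := by
    refine hI.eq_zero_of_mul_right z fun x hx => hJ.eq_zero_of_mul_right _ fun y hy => ?_
    rw [← mul_assoc]
    exact hz _ ⟨hI.mul_mem_left y hx, hJ.mul_mem_right x hy⟩

theorem isDenseIdeal_top [IsScalarTower Φ A A] [SMulCommClass Φ A A] [SemiprimeAlgebra Φ A] :
    IsDenseIdeal (⊤ : Submodule Φ A) where
  mul_mem_left _ _ _ := trivial
  mul_mem_right _ _ _ := trivial
  eq_zero_of_mul_left z hz := by
    let N : Submodule Φ A :=
      { carrier := {z | ∀ x : A, z * x = 0}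
        add_mem' := fun {a b} ha hb x => by rw [add_mul, ha x, hb x, add_zero]
        zero_mem' := fun x => zero_mul x
        smul_mem' := fun c a ha x => by rw [smul_mul_assoc, ha x, smul_zero] }
    have hN : N = ⊥ := SemiprimeAlgebra.eq_bot_of_sq_eq_zero N
      ⟨fun a x hx y => by rw [mul_assoc, hx y, mul_zero],
        fun a x hx y => by rw [mul_assoc, hx (a * y)]⟩ (fun x hx y _ => hx y)
    have : z ∈ N := fun x => hz x trivial
    rwa [hN, Submodule.mem_bot] at this
  eq_zero_of_mul_right z hz := by
    let N : Submodule Φ A :=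
      { carrier := {z | ∀ x : A, x * z = 0}
        add_mem' := fun {a b} ha hb x => by rw [mul_add, ha x, hb x, add_zero]
        zero_mem' := fun x => mul_zero x
        smul_mem' := fun c a ha x => by rw [mul_smul_comm, ha x, smul_zero] }
    have hN : N = ⊥ := SemiprimeAlgebra.eq_bot_of_sq_eq_zero N
      ⟨fun a x hx y => by rw [← mul_assoc, hx (y * a)],
        fun a x hx y => by rw [← mul_assoc, hx y, zero_mul]⟩ (fun x _ y hy => hy x)
    have : z ∈ N := fun x => hz x trivial
    rwa [hN, Submodule.mem_bot] at this

namespace PartialMultiplier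

/-- Two partial multipliers are identified when they agree on the intersection of their domains
(equivalently, on some dense ideal contained in both domains). -/
def Rel (p q : PartialMultiplier Φ A) : Prop :=
  ∀ (x : A) (hp : x ∈ p.dom) (hq : x ∈ q.dom),
    p.left ⟨x, hp⟩ = q.left ⟨x, hq⟩ ∧ p.right ⟨x, hp⟩ = q.right ⟨x, hq⟩

theorem rel_trans {p q s : PartialMultiplier Φ A} (h₁ : Rel p q) (h₂ : Rel q s) : Rel p s := by
  intro x hp hs
  constructor
  · refine sub_eq_zero.1 (q.dense.eq_zero_of_mul_left _ fun y hy => ?_)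
    have hq := q.dense.mul_mem_left x hy
    have e₁ := (h₁ (x * y) (p.dense.mul_mem_right y hp) hq).1
    have e₂ := (h₂ (x * y) hq (s.dense.mul_mem_right y hs)).1
    rw [sub_mul, ← p.left_mul ⟨x, hp⟩ y, ← s.left_mul ⟨x, hs⟩ y, sub_eq_zero]
    exact e₁.trans e₂
  · refine sub_eq_zero.1 (q.dense.eq_zero_of_mul_right _ fun y hy => ?_)
    have hq := q.dense.mul_mem_right x hy
    have e₁ := (h₁ (y * x) (p.dense.mul_mem_left y hp) hq).2
    have e₂ := (h₂ (y * x) hq (s.dense.mul_mem_left y hs)).2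
    rw [mul_sub, ← p.right_mul y ⟨x, hp⟩, ← s.right_mul y ⟨x, hs⟩, sub_eq_zero]
    exact e₁.trans e₂

variable (Φ A) in
/-- The setoid of partial multipliers. -/
def setoid : Setoid (PartialMultiplier Φ A) where
  r := Rel
  iseqv :=
    { refl := fun _ _ _ _ => ⟨rfl, rfl⟩
      symm := fun h x hp hq => ⟨(h x hq hp).1.symm, (h x hq hp).2.symm⟩
      trans := rel_trans }

/-- The sum of two partial multipliers, defined on the intersection of the domains. -/
def add (p q : PartialMultiplier Φ A) : PartialMultiplier Φ A where
  dom := p.dom ⊓ q.dom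
  dense := p.dense.inf q.dense
  left := p.left.comp (Submodule.inclusion inf_le_left) +
    q.left.comp (Submodule.inclusion inf_le_right)
  right := p.right.comp (Submodule.inclusion inf_le_left) +
    q.right.comp (Submodule.inclusion inf_le_right)
  left_mul x a := by
    have h₁ := p.left_mul ⟨x, x.2.1⟩ a
    have h₂ := q.left_mul ⟨x, x.2.2⟩ a
    simp only [LinearMap.add_apply, LinearMap.comp_apply, add_mul]
    exact congrArg₂ (· + ·) h₁ h₂
  right_mul a x := by
    have h₁ := p.right_mul a ⟨x, x.2.1⟩
    have h₂ := q.right_mul a ⟨x, x.2.2⟩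
    simp only [LinearMap.add_apply, LinearMap.comp_apply, mul_add]
    exact congrArg₂ (· + ·) h₁ h₂
  balanced x y := by
    have h₁ := p.balanced ⟨x, x.2.1⟩ ⟨y, y.2.1⟩
    have h₂ := q.balanced ⟨x, x.2.2⟩ ⟨y, y.2.2⟩
    simp only [LinearMap.add_apply, LinearMap.comp_apply, add_mul, mul_add]
    exact congrArg₂ (· + ·) h₁ h₂

/-- The multiple `c q` of a partial multiplier by a scalar `c`. -/
def smul [IsScalarTower Φ A A] [SMulCommClass Φ A A] (c : Φ) (p : PartialMultiplier Φ A) :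
    PartialMultiplier Φ A where
  dom := p.dom
  dense := p.dense
  left := c • p.left
  right := c • p.right
  left_mul x a := by simp only [LinearMap.smul_apply, p.left_mul, smul_mul_assoc]
  right_mul a x := by simp only [LinearMap.smul_apply, p.right_mul, mul_smul_comm]
  balanced x y := by
    simp only [LinearMap.smul_apply, mul_smul_comm, smul_mul_assoc, p.balanced]

theorem apply_mem_congr {I J : Submodule Φ A} (f : I →ₗ[Φ] A) {x : I} {y : A} (hy : y ∈ I)
    (h : (x : A) = y) (hx : f x ∈ J) : f ⟨y, hy⟩ ∈ J := by
  subst h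
  exact hx

/-- The domain of the product `p q`: the largest two-sided ideal on which `x ↦ p (q x)` and
`x ↦ (x p) q` are both defined. -/
def mulDom [IsScalarTower Φ A A] [SMulCommClass Φ A A] (p q : PartialMultiplier Φ A) :
    Submodule Φ A where
  carrier := {x | ∃ (hp : x ∈ p.dom) (hq : x ∈ q.dom),
    q.left ⟨x, hq⟩ ∈ p.dom ∧ (∀ a, q.left ⟨a * x, q.dense.mul_mem_left a hq⟩ ∈ p.dom) ∧
    p.right ⟨x, hp⟩ ∈ q.dom ∧ ∀ a, p.right ⟨x * a, p.dense.mul_mem_right a hp⟩ ∈ q.dom}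
  zero_mem' := by
    refine ⟨zero_mem _, zero_mem _, ?_, fun a => ?_, ?_, fun a => ?_⟩
    · exact (map_zero q.left).symm ▸ zero_mem p.dom
    · exact apply_mem_congr q.left _ (mul_zero a).symm ((map_zero q.left).symm ▸ zero_mem p.dom)
    · exact (map_zero p.right).symm ▸ zero_mem q.dom
    · exact apply_mem_congr p.right _ (zero_mul a).symm ((map_zero p.right).symm ▸ zero_mem q.dom)
  add_mem' := by
    rintro x y ⟨hp, hq, h₁, h₂, h₃, h₄⟩ ⟨hp', hq', h₁', h₂', h₃', h₄'⟩
    refine ⟨add_mem hp hp', add_mem hq hq', ?_, fun a => ?_, ?_, fun a => ?_⟩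
    · have := add_mem h₁ h₁'
      rwa [← map_add] at this
    · have := add_mem (h₂ a) (h₂' a)
      rw [← map_add] at this
      exact apply_mem_congr q.left _ (mul_add a x y).symm this
    · have := add_mem h₃ h₃'
      rwa [← map_add] at this
    · have := add_mem (h₄ a) (h₄' a)
      rw [← map_add] at this
      exact apply_mem_congr p.right _ (add_mul x y a).symm this
  smul_mem' := by
    rintro c x ⟨hp, hq, h₁, h₂, h₃, h₄⟩
    refine ⟨p.dom.smul_mem c hp, q.dom.smul_mem c hq, ?_, fun a => ?_, ?_, fun a => ?_⟩
    · have := p.dom.smul_mem c h₁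
      rwa [← map_smul] at this
    · have := p.dom.smul_mem c (h₂ a)
      rw [← map_smul] at this
      exact apply_mem_congr q.left _ (mul_smul_comm c a x).symm this
    · have := q.dom.smul_mem c h₃
      rwa [← map_smul] at this
    · have := q.dom.smul_mem c (h₄ a)
      rw [← map_smul] at this
      exact apply_mem_congr p.right _ (smul_mul_assoc c x a).symm this

section mul

variable [IsScalarTower Φ A A] [SMulCommClass Φ A A]

theorem mulDom_le_left (p q : PartialMultiplier Φ A) : mulDom p q ≤ p.dom := fun _ h => h.1

theorem mulDom_le_right (p q : PartialMultiplier Φ A) : mulDom p q ≤ q.dom := fun _ h => h.2.1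

theorem mul_mem_mulDom (p q : PartialMultiplier Φ A) {x y : A} (hx : x ∈ p.dom ⊓ q.dom)
    (hy : y ∈ p.dom ⊓ q.dom) : x * y ∈ mulDom p q := by
  have L : ∀ z (hz : z ∈ q.dom), q.left ⟨z * y, q.dense.mul_mem_right y hz⟩ ∈ p.dom := by
    intro z hz
    rw [q.left_mul ⟨z, hz⟩ y]
    exact p.dense.mul_mem_left _ hy.1
  have R : ∀ z (hz : z ∈ p.dom), p.right ⟨x * z, p.dense.mul_mem_left x hz⟩ ∈ q.dom := by
    intro z hz
    rw [p.right_mul x ⟨z, hz⟩]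
    exact q.dense.mul_mem_right _ hx.2
  refine ⟨p.dense.mul_mem_right y hx.1, q.dense.mul_mem_right y hx.2, L x hx.2, fun a => ?_,
    R y hy.1, fun a => ?_⟩
  · simpa only [mul_assoc] using L (a * x) (q.dense.mul_mem_left a hx.2)
  · simpa only [mul_assoc] using R (y * a) (p.dense.mul_mem_right a hy.1)

theorem isDenseIdeal_mulDom (p q : PartialMultiplier Φ A) : IsDenseIdeal (mulDom p q) where
  mul_mem_left := by
    rintro b x ⟨hp, hq, h₁, h₂, h₃, h₄⟩
    refine ⟨p.dense.mul_mem_left b hp, q.dense.mul_mem_left b hq, h₂ b, fun a => ?_, ?_,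
      fun a => ?_⟩
    · simpa only [mul_assoc] using h₂ (a * b)
    · rw [p.right_mul b ⟨x, hp⟩]
      exact q.dense.mul_mem_left b h₃
    · have := q.dense.mul_mem_left b (h₄ a)
      rw [← p.right_mul b ⟨x * a, _⟩] at this
      simpa only [mul_assoc] using this
  mul_mem_right := by
    rintro b x ⟨hp, hq, h₁, h₂, h₃, h₄⟩
    refine ⟨p.dense.mul_mem_right b hp, q.dense.mul_mem_right b hq, ?_, fun a => ?_, h₄ b,
      fun a => ?_⟩
    · rw [q.left_mul ⟨x, hq⟩ b]
      exact p.dense.mul_mem_right b h₁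
    · have := p.dense.mul_mem_right b (h₂ a)
      rw [← q.left_mul ⟨a * x, _⟩ b] at this
      simpa only [mul_assoc] using this
    · simpa only [mul_assoc] using h₄ (b * a)
  eq_zero_of_mul_left z hz := by
    have hI := p.dense.inf q.dense
    refine hI.eq_zero_of_mul_left z fun x hx => hI.eq_zero_of_mul_left _ fun y hy => ?_
    rw [mul_assoc]
    exact hz _ (mul_mem_mulDom p q hx hy)
  eq_zero_of_mul_right z hz := by
    have hI := p.dense.inf q.dense
    refine hI.eq_zero_of_mul_right z fun x hx => hI.eq_zero_of_mul_right _ fun y hy => ?_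
    rw [← mul_assoc]
    exact hz _ (mul_mem_mulDom p q hy hx)

/-- The product of two partial multipliers: `x ↦ p (q x)` on the left, `x ↦ (x p) q` on the
right. -/
def mul (p q : PartialMultiplier Φ A) : PartialMultiplier Φ A where
  dom := mulDom p q
  dense := isDenseIdeal_mulDom p q
  left := p.left.comp ((q.left.comp (Submodule.inclusion (mulDom_le_right p q))).codRestrict p.dom
    fun x => x.2.2.2.1)
  right := q.right.comp ((p.right.comp (Submodule.inclusion (mulDom_le_left p q))).codRestrict
    q.dom fun x => x.2.2.2.2.2.1)
  left_mul x a := by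
    have h := q.left_mul ⟨x, x.2.2.1⟩ a
    have h' := p.left_mul ⟨q.left ⟨x, x.2.2.1⟩, x.2.2.2.1⟩ a
    refine Eq.trans ?_ h'
    exact congrArg p.left (Subtype.ext h)
  right_mul a x := by
    have h := p.right_mul a ⟨x, x.2.1⟩
    have h' := q.right_mul a ⟨p.right ⟨x, x.2.1⟩, x.2.2.2.2.2.1⟩
    refine Eq.trans ?_ h'
    exact congrArg q.right (Subtype.ext h)
  balanced x y := by
    have h := p.balanced ⟨x, x.2.1⟩ ⟨q.left ⟨y, y.2.2.1⟩, y.2.2.2.1⟩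
    have h' := q.balanced ⟨p.right ⟨x, x.2.1⟩, x.2.2.2.2.2.1⟩ ⟨y, y.2.2.1⟩
    exact h.trans h'

/-- Multiplication by an element `a` of `A`, a multiplier defined on all of `A`. -/
def ofElem [SemiprimeAlgebra Φ A] (a : A) : PartialMultiplier Φ A where
  dom := ⊤
  dense := isDenseIdeal_top
  left := (LinearMap.mulLeft Φ a).comp (Submodule.subtype ⊤)
  right := (LinearMap.mulRight Φ a).comp (Submodule.subtype ⊤)
  left_mul x b := (mul_assoc a (x : A) b).symm
  right_mul b x := mul_assoc b (x : A) a
  balanced x y := (mul_assoc (x : A) a (y : A)).symm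

end mul

end PartialMultiplier

variable (Φ A) in
/-- The symmetric Martindale algebra of quotients `Q_s(A)` of a semiprime algebra `A`. -/
def SymmetricQuotients : Type _ := Quotient (PartialMultiplier.setoid Φ A)

namespace SymmetricQuotients

open PartialMultiplier

variable [IsScalarTower Φ A A] [SMulCommClass Φ A A]

instance : Add (SymmetricQuotients Φ A) :=
  ⟨Quotient.map₂ PartialMultiplier.add fun _ _ h _ _ h' x hp hq =>
    ⟨congrArg₂ (· + ·) (h x hp.1 hq.1).1 (h' x hp.2 hq.2).1,
      congrArg₂ (· + ·) (h x hp.1 hq.1).2 (h' x hp.2 hq.2).2⟩⟩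

instance : SMul Φ (SymmetricQuotients Φ A) :=
  ⟨fun c => Quotient.map (PartialMultiplier.smul c) fun _ _ h x hp hq =>
    ⟨congrArg (c • ·) (h x hp hq).1, congrArg (c • ·) (h x hp hq).2⟩⟩

instance : Mul (SymmetricQuotients Φ A) :=
  ⟨Quotient.map₂ PartialMultiplier.mul fun p p' h q q' h' x hx hx' => by
    have e := h' x hx.2.1 hx'.2.1
    have f := h x hx.1 hx'.1
    constructor
    · have m : q.left ⟨x, hx.2.1⟩ ∈ p'.dom := by
        rw [e.1]; exact hx'.2.2.1
      refine (h (q.left ⟨x, hx.2.1⟩) hx.2.2.1 m).1.trans ?_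
      exact congrArg p'.left (Subtype.ext e.1)
    · have m : p.right ⟨x, hx.1⟩ ∈ q'.dom := by
        rw [f.2]; exact hx'.2.2.2.2.1
      refine (h' (p.right ⟨x, hx.1⟩) hx.2.2.2.2.1 m).2.trans ?_
      exact congrArg q'.right (Subtype.ext f.2)⟩

variable [SemiprimeAlgebra Φ A]

instance : Zero (SymmetricQuotients Φ A) := ⟨Quotient.mk _ (ofElem 0)⟩

instance : Neg (SymmetricQuotients Φ A) := ⟨fun q => (-1 : Φ) • q⟩

instance : NonUnitalRing (SymmetricQuotients Φ A) where
  add_assoc := by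
    rintro ⟨p⟩ ⟨q⟩ ⟨s⟩
    exact Quotient.sound fun x _ _ => ⟨add_assoc _ _ _, add_assoc _ _ _⟩
  zero_add := by
    rintro ⟨p⟩
    refine Quotient.sound fun x hx hx' => ⟨?_, ?_⟩
    · exact (congrArg (· + p.left ⟨x, hx'⟩) (zero_mul x)).trans (zero_add _)
    · exact (congrArg (· + p.right ⟨x, hx'⟩) (mul_zero x)).trans (zero_add _)
  add_zero := by
    rintro ⟨p⟩
    refine Quotient.sound fun x hx hx' => ⟨?_, ?_⟩
    · exact (congrArg (p.left ⟨x, hx'⟩ + ·) (zero_mul x)).trans (add_zero _)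
    · exact (congrArg (p.right ⟨x, hx'⟩ + ·) (mul_zero x)).trans (add_zero _)
  add_comm := by
    rintro ⟨p⟩ ⟨q⟩
    exact Quotient.sound fun x _ _ => ⟨add_comm _ _, add_comm _ _⟩
  neg_add_cancel := by
    rintro ⟨p⟩
    refine Quotient.sound fun x hx hx' => ⟨?_, ?_⟩
    · refine Eq.trans ?_ (zero_mul x).symm
      change (-1 : Φ) • p.left ⟨x, hx.1⟩ + p.left ⟨x, hx.1⟩ = 0
      rw [neg_one_smul, neg_add_cancel]
    · refine Eq.trans ?_ (mul_zero x).symm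
      change (-1 : Φ) • p.right ⟨x, hx.1⟩ + p.right ⟨x, hx.1⟩ = 0
      rw [neg_one_smul, neg_add_cancel]
  nsmul := nsmulRec
  zsmul := zsmulRec
  mul_assoc := by
    rintro ⟨p⟩ ⟨q⟩ ⟨s⟩
    exact Quotient.sound fun x _ _ => ⟨rfl, rfl⟩
  left_distrib := by
    rintro ⟨p⟩ ⟨q⟩ ⟨s⟩
    refine Quotient.sound fun x hx hx' => ⟨?_, rfl⟩
    exact map_add p.left ⟨q.left ⟨x, hx'.1.2.1⟩, hx'.1.2.2.1⟩ ⟨s.left ⟨x, hx'.2.2.1⟩, hx'.2.2.2.1⟩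
  right_distrib := by
    rintro ⟨p⟩ ⟨q⟩ ⟨s⟩
    refine Quotient.sound fun x hx hx' => ⟨rfl, ?_⟩
    exact map_add s.right ⟨p.right ⟨x, hx'.1.1⟩, hx'.1.2.2.2.2.1⟩
      ⟨q.right ⟨x, hx'.2.1⟩, hx'.2.2.2.2.2.1⟩
  zero_mul := by
    rintro ⟨p⟩
    refine Quotient.sound fun x hx _ => ⟨?_, ?_⟩
    · exact (zero_mul (p.left ⟨x, hx.2.1⟩)).trans (zero_mul x).symm
    · refine Eq.trans ?_ ((map_zero p.right).trans (mul_zero x).symm)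
      exact congrArg p.right (Subtype.ext (mul_zero x))
  mul_zero := by
    rintro ⟨p⟩
    refine Quotient.sound fun x hx _ => ⟨?_, ?_⟩
    · refine Eq.trans ?_ ((map_zero p.left).trans (zero_mul x).symm)
      exact congrArg p.left (Subtype.ext (zero_mul x))
    · exact (mul_zero (p.right ⟨x, hx.1⟩)).trans (mul_zero x).symm

instance : Module Φ (SymmetricQuotients Φ A) where
  one_smul := by
    rintro ⟨p⟩
    exact Quotient.sound fun x _ _ => ⟨one_smul _ _, one_smul _ _⟩
  mul_smul := by
    rintro c d ⟨p⟩
    exact Quotient.sound fun x _ _ => ⟨mul_smul _ _ _, mul_smul _ _ _⟩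
  smul_zero := by
    intro c
    refine Quotient.sound fun x _ _ => ⟨?_, ?_⟩
    · exact (congrArg (c • ·) (zero_mul x)).trans ((smul_zero c).trans (zero_mul x).symm)
    · exact (congrArg (c • ·) (mul_zero x)).trans ((smul_zero c).trans (mul_zero x).symm)
  smul_add := by
    rintro c ⟨p⟩ ⟨q⟩
    exact Quotient.sound fun x _ _ => ⟨smul_add _ _ _, smul_add _ _ _⟩
  add_smul := by
    rintro c d ⟨p⟩
    exact Quotient.sound fun x _ _ => ⟨add_smul _ _ _, add_smul _ _ _⟩
  zero_smul := by
    rintro ⟨p⟩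
    refine Quotient.sound fun x hx _ => ⟨?_, ?_⟩
    · exact (zero_smul Φ (p.left ⟨x, hx⟩)).trans (zero_mul x).symm
    · exact (zero_smul Φ (p.right ⟨x, hx⟩)).trans (mul_zero x).symm

instance : IsScalarTower Φ (SymmetricQuotients Φ A) (SymmetricQuotients Φ A) where
  smul_assoc := by
    rintro c ⟨p⟩ ⟨q⟩
    refine Quotient.sound fun x hx hx' => ⟨rfl, ?_⟩
    exact map_smul q.right c ⟨p.right ⟨x, hx'.1⟩, hx'.2.2.2.2.1⟩

instance : SMulCommClass Φ (SymmetricQuotients Φ A) (SymmetricQuotients Φ A) where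
  smul_comm := by
    rintro c ⟨p⟩ ⟨q⟩
    refine Quotient.sound fun x hx hx' => ⟨?_, rfl⟩
    exact (map_smul p.left c ⟨q.left ⟨x, hx.2.1⟩, hx.2.2.1⟩).symm

variable (Φ A) in
/-- The canonical homomorphism `A → Q_s(A)`; it is injective because `A` is semiprime. -/
def incl : A →ₙₐ[Φ] SymmetricQuotients Φ A where
  toFun a := Quotient.mk _ (ofElem a)
  map_smul' c a := Quotient.sound fun x _ _ => ⟨smul_mul_assoc c a x, mul_smul_comm c x a⟩
  map_zero' := rfl
  map_add' a b := Quotient.sound fun x _ _ => ⟨add_mul a b x, mul_add x a b⟩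
  map_mul' a b := Quotient.sound fun x _ _ => ⟨mul_assoc a b x, (mul_assoc x a b).symm⟩

end SymmetricQuotients

end Associative

/-! ### The Lie algebra of an associative algebra -/

/-- The Lie algebra `A⁻` of an associative algebra `A`: the module `A` with `[x, y] = xy - yx`. -/
def MinusAlgebra (A : Type*) : Type _ := A

namespace MinusAlgebra

variable (Φ : Type*) [CommRing Φ] {A : Type*} [NonUnitalRing A] [Module Φ A]

instance : AddCommGroup (MinusAlgebra A) := inferInstanceAs (AddCommGroup A)

instance : Module Φ (MinusAlgebra A) := inferInstanceAs (Module Φ A)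

/-- The identity map `A → A⁻`. -/
def of : A ≃ₗ[Φ] MinusAlgebra A := LinearEquiv.refl Φ A

instance : LieRing (MinusAlgebra A) where
  bracket := fun (x y : A) => (x * y - y * x : A)
  add_lie := fun (x y z : A) => show (x + y) * z - z * (x + y) =
      (x * z - z * x) + (y * z - z * y) by
    rw [add_mul, mul_add, add_sub_add_comm]
  lie_add := fun (x y z : A) => show x * (y + z) - (y + z) * x =
      (x * y - y * x) + (x * z - z * x) by
    rw [add_mul, mul_add, add_sub_add_comm]
  lie_self := fun (x : A) => sub_self (x * x)
  leibniz_lie := fun (x y z : A) => show x * (y * z - z * y) - (y * z - z * y) * x =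
      ((x * y - y * x) * z - z * (x * y - y * x)) +
      (y * (x * z - z * x) - (x * z - z * x) * y) by
    simp only [mul_sub, sub_mul, mul_assoc]
    abel

instance [IsScalarTower Φ A A] [SMulCommClass Φ A A] : LieAlgebra Φ (MinusAlgebra A) where
  lie_smul := fun (c : Φ) (x y : A) => show x * (c • y) - (c • y) * x = c • (x * y - y * x) by
    rw [mul_smul_comm, smul_mul_assoc, smul_sub]

end MinusAlgebra

/-! ### Graded algebras of quotients of graded Lie algebras -/

section Lie

open DirectSum

variable {G : Type*} [AddCommGroup G] [DecidableEq G] {Φ : Type*} [CommRing Φ]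

/-- `L = ⨁ L_σ` is a `G`-graded Lie algebra. -/
structure IsLieGrading {L : Type*} [LieRing L] [LieAlgebra Φ L] (𝓛 : G → Submodule Φ L) :
    Prop where
  isInternal : IsInternal 𝓛
  graded : SetLike.GradedBracket 𝓛

variable {L M : Type*} [LieRing L] [LieAlgebra Φ L] [LieRing M] [LieAlgebra Φ M]

/-- For a subalgebra `L` of `M` (given by its inclusion `f`) and `q : M`, the linear span in `M`
of `q` and of all `ad x₁ ⋯ ad xₙ q` with `x₁, …, xₙ ∈ L`. -/
def adSpan (f : L →ₗ⁅Φ⁆ M) (q : M) : Submodule Φ M :=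
  Submodule.span Φ {m | ∃ l : List L, m = l.foldr (fun x y => ⁅f x, y⁆) q}

/-- `f` identifies the graded Lie algebra `L` with a graded subalgebra of the graded Lie algebra
`M`, and `M` is a graded algebra of quotients of `L`. -/
structure IsGradedAlgebraOfQuotients (𝓛 : G → Submodule Φ L) (𝓜 : G → Submodule Φ M)
    (f : L →ₗ⁅Φ⁆ M) : Prop where
  grading_sub : IsLieGrading 𝓛
  grading : IsLieGrading 𝓜
  injective : Function.Injective f
  map_mem : ∀ σ, ∀ x ∈ 𝓛 σ, f x ∈ 𝓜 σ
  absorb : ∀ σ τ, ∀ p ∈ 𝓜 σ, p ≠ 0 → ∀ q ∈ 𝓜 τ, ∃ α, ∃ x ∈ 𝓛 α,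
    ⁅f x, p⁆ ≠ 0 ∧ ∀ m ∈ adSpan f q, ⁅f x, m⁆ ∈ f.range

variable (Φ) in
/-- The Lie algebra `L / Z_L`. -/
abbrev ModCenter (L : Type*) [LieRing L] [LieAlgebra Φ L] : Type _ := L ⧸ LieAlgebra.center Φ L

variable (Φ) in
/-- The canonical projection `L → L / Z_L`. -/
abbrev toModCenter (L : Type*) [LieRing L] [LieAlgebra Φ L] : L →ₗ[Φ] ModCenter Φ L :=
  (LieSubmodule.Quotient.mk' (LieAlgebra.center Φ L) : L →ₗ[Φ] ModCenter Φ L)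

/-- The grading of `L / Z_L` induced by a grading of `L`. -/
def modCenterGrading (𝓛 : G → Submodule Φ L) (σ : G) : Submodule Φ (ModCenter Φ L) :=
  (𝓛 σ).map (toModCenter Φ L)

variable (Φ) in
/-- The derived ideal `[L, L]` (the linear span of the brackets), itself a Lie algebra. -/
abbrev derivedIdeal (L : Type*) [LieRing L] [LieAlgebra Φ L] : LieIdeal Φ L :=
  ⁅(⊤ : LieIdeal Φ L), (⊤ : LieIdeal Φ L)⁆

/-- The grading of `[L, L]` induced by a grading of `L`: `[L, L]_σ = [L, L] ∩ L_σ`. -/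
def derivedGrading (𝓛 : G → Submodule Φ L) (σ : G) : Submodule Φ (derivedIdeal Φ L) :=
  (𝓛 σ).comap (derivedIdeal Φ L).toSubmodule.subtype

/-- The grading of `A⁻` given by a grading of the associative algebra `A`. -/
def minusGrading {A : Type*} [NonUnitalRing A] [Module Φ A] (𝒜 : G → Submodule Φ A) (σ : G) :
    Submodule Φ (MinusAlgebra A) :=
  (𝒜 σ).map (MinusAlgebra.of Φ : A ≃ₗ[Φ] MinusAlgebra A).toLinearMap

end Lie

/-!
Every `q ∈ Q` is multiplied into `A`, from both sides, by a dense ideal of `A`. If `q` is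
homogeneous, the homogeneous components of the elements of that ideal do so too; hence the dense
ideal `I` can be chosen graded. Then `[I, q] ⊆ A`, and the Jacobi identity gives `[I, _L(q)] ⊆ A`
because `I` is a Lie ideal of `A⁻`; likewise `[[I, I], _L(q)] ⊆ [A, A]` for `q ∈ [Q, Q]`.

It remains to see that `I`, respectively `[I, I]`, detects elements outside the center; since `I`
is graded, a homogeneous detecting element then exists. If `[I, p]` is central, then
`[[I, I], p] = 0` by the Jacobi identity. In that case, for `y` with `y p ∈ I`, expanding
`[[x, y p], p] = 0` gives `y [[x, p], p] + [y, p] [x, p] = 0`, and replacing `y` by `x y` gives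
`[x, p] y [x, p] = 0`. So `[x, p] = 0` by semiprimeness, and `p` is central.

If only `[[I, I], p]` is central, let `u = [a, b]` with `a, b ∈ I` and `c = [u, p]`. Applying the
hypothesis to the commutators `[u, x]` and `[u, u x] = u [u, x]` gives `c [u, [u, x]] = 0` for
`x ∈ I`. Replacing `x` by `x y` gives `2 c [u, x] [u, y] = 0`; hence `c [u, x] = 0` when `A` is
2-torsion free and semiprime. So `c u` is central, therefore `c² = [c u, p] = 0`, and `c = 0`
because a semiprime algebra has no nonzero central element of square zero.
-/

/-! ### Commutators in a non-unital ring -/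

section Commutator

variable {R : Type*} [NonUnitalRing R]

/-- The Lie ring structure on a non-unital ring given by commutators. It is kept on the ring itself,
rather than on `MinusAlgebra`, so that computations can mix the bracket with the product. -/
abbrev commutatorLieRing (R : Type*) [NonUnitalRing R] : LieRing R where
  __ := Ring.instBracket
  add_lie := add_lie (L := MinusAlgebra R) (M := MinusAlgebra R)
  lie_add := lie_add (L := MinusAlgebra R) (M := MinusAlgebra R)
  lie_self := lie_self (L := MinusAlgebra R)
  leibniz_lie := LieRing.leibniz_lie (L := MinusAlgebra R)

theorem lie_mul_leibniz (p x y : R) : ⁅p, x * y⁆ = ⁅p, x⁆ * y + x * ⁅p, y⁆ := by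
  simp only [Ring.lie_def, mul_sub, sub_mul, mul_assoc]
  abel

theorem mul_lie_leibniz (x y p : R) : ⁅x * y, p⁆ = x * ⁅y, p⁆ + ⁅x, p⁆ * y := by
  simp only [Ring.lie_def, mul_sub, sub_mul, mul_assoc]
  abel

theorem mem_center_iff_lie_eq_zero {p : R} : p ∈ Set.center R ↔ ∀ z : R, ⁅z, p⁆ = 0 := by
  simp only [Semigroup.mem_center_iff, Ring.lie_def, sub_eq_zero]

theorem map_commutator {S F : Type*} [NonUnitalRing S] [FunLike F R S]
    [NonUnitalRingHomClass F R S] (f : F) (x y : R) : f ⁅x, y⁆ = ⁅f x, f y⁆ := by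
  simp only [Ring.lie_def, map_sub, map_mul]

attribute [local instance] commutatorLieRing

theorem lie_mul_lie_lie_eq_zero {p u x : R} (hu : ⁅u, p⁆ ∈ Set.center R)
    (hx : ⁅u, ⁅⁅u, x⁆, p⁆⁆ = 0) (hux : ⁅u, ⁅⁅u, u * x⁆, p⁆⁆ = 0) :
    ⁅u, p⁆ * ⁅u, ⁅u, x⁆⁆ = 0 := by
  rwa [lie_mul_leibniz, lie_self, zero_mul, zero_add, mul_lie_leibniz, lie_add, lie_mul_leibniz,
    lie_mul_leibniz, hx, lie_self, mem_center_iff_lie_eq_zero.1 hu, zero_mul, zero_mul, mul_zero,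
    zero_add, zero_add, zero_add] at hux

theorem add_self_mul_lie_mul_lie_eq_zero {c u x y : R} (hc : c ∈ Set.center R)
    (hx : c * ⁅u, ⁅u, x⁆⁆ = 0) (hy : c * ⁅u, ⁅u, y⁆⁆ = 0) (hxy : c * ⁅u, ⁅u, x * y⁆⁆ = 0) :
    c * ⁅u, x⁆ * ⁅u, y⁆ + c * ⁅u, x⁆ * ⁅u, y⁆ = 0 := by
  have hxy' : c * (x * ⁅u, ⁅u, y⁆⁆) = 0 := by
    rw [← mul_assoc, ← Semigroup.mem_center_iff.1 hc, mul_assoc, hy, mul_zero]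
  rwa [lie_mul_leibniz, lie_add, lie_mul_leibniz, lie_mul_leibniz, mul_add, mul_add, mul_add,
    ← mul_assoc, hx, zero_mul, zero_add, hxy', add_zero, ← mul_assoc] at hxy

end Commutator

/-! ### Dense ideals -/

section DenseIdeals

open scoped Pointwise

variable {Φ : Type*} [CommRing Φ] {A : Type*} [NonUnitalRing A] [Module Φ A]
  [IsScalarTower Φ A A] [SMulCommClass Φ A A]

theorem IsTwoSidedIdeal.span {s : Set A} (hl : ∀ a, ∀ x ∈ s, a * x ∈ Submodule.span Φ s)
    (hr : ∀ a, ∀ x ∈ s, x * a ∈ Submodule.span Φ s) : IsTwoSidedIdeal (Submodule.span Φ s) where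
  mul_mem_left a _ hx :=
    Submodule.span_le (p := (Submodule.span Φ s).comap (LinearMap.mulLeft Φ a)).2 (hl a) hx
  mul_mem_right a _ hx :=
    Submodule.span_le (p := (Submodule.span Φ s).comap (LinearMap.mulRight Φ a)).2 (hr a) hx

theorem IsDenseIdeal.span_mul {I J : Submodule Φ A} (hI : IsDenseIdeal I) (hJ : IsDenseIdeal J) :
    IsDenseIdeal (Submodule.span Φ ((I : Set A) * (J : Set A))) where
  toIsTwoSidedIdeal := by
    refine .span ?_ ?_ <;> rintro a _ ⟨x, hx, y, hy, rfl⟩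
    · exact Submodule.subset_span ⟨a * x, hI.mul_mem_left a hx, y, hy, mul_assoc a x y⟩
    · exact Submodule.subset_span ⟨x, hx, y * a, hJ.mul_mem_right a hy, (mul_assoc x y a).symm⟩
  eq_zero_of_mul_left z hz := hI.eq_zero_of_mul_left z fun x hx ↦
    hJ.eq_zero_of_mul_left _ fun y hy ↦ by
      rw [mul_assoc, hz _ (Submodule.subset_span (Set.mul_mem_mul hx hy))]
  eq_zero_of_mul_right z hz := hJ.eq_zero_of_mul_right z fun y hy ↦
    hI.eq_zero_of_mul_right _ fun x hx ↦ by
      rw [← mul_assoc, hz _ (Submodule.subset_span (Set.mul_mem_mul hx hy))]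

theorem SemiprimeAlgebra.eq_zero_of_mul_mul_self [SemiprimeAlgebra Φ A] {b : A}
    (hb : ∀ a, b * a * b = 0) : b = 0 := by
  let I : Submodule Φ A := Submodule.span Φ {z | ∃ x y, x * b * y = z}
  have hI_mem (x y : A) : x * b * y ∈ I := Submodule.subset_span ⟨x, y, rfl⟩
  have hI_ideal : IsTwoSidedIdeal I := by
    refine .span ?_ ?_ <;> rintro a _ ⟨x, y, rfl⟩
    · rw [← mul_assoc, ← mul_assoc]
      exact hI_mem (a * x) y
    · rw [mul_assoc]
      exact hI_mem x (y * a)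
  have hI_sq : ∀ x ∈ I, ∀ y ∈ I, x * y = 0 := fun x hx y hy ↦ by
    refine Submodule.span_induction₂ (p := fun x y _ _ ↦ x * y = 0) ?_ ?_ ?_ ?_ ?_ ?_ ?_ hx hy
    · rintro _ _ ⟨x, y, rfl⟩ ⟨x', y', rfl⟩
      calc x * b * y * (x' * b * y') = x * (b * (y * x') * b) * y' := by simp only [mul_assoc]
        _ = 0 := by rw [hb, mul_zero, zero_mul]
    all_goals simp +contextual [add_mul, mul_add, smul_mul_assoc, mul_smul_comm]
  have hI_bot : I = ⊥ := SemiprimeAlgebra.eq_bot_of_sq_eq_zero I hI_ideal hI_sq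
  have hA : IsDenseIdeal (⊤ : Submodule Φ A) := isDenseIdeal_top
  refine hA.eq_zero_of_mul_right b fun x _ ↦ hA.eq_zero_of_mul_left _ fun y _ ↦ ?_
  exact (Submodule.mem_bot Φ).1 (hI_bot ▸ hI_mem x y)

end DenseIdeals

/-! ### Algebras of quotients with dense denominator ideals -/

/-- An embedding `ι : A → Q` such that every element of `Q` is multiplied into `A`, from both sides,
by some dense ideal of `A`, and such that dense ideals of `A` have no annihilators in `Q`. For
semiprime `A` these are, up to isomorphism, the subalgebras of the symmetric Martindale algebra of
quotients of `A` that contain `A`. -/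
structure HasDenseDenominators {Φ A Q : Type*} [CommRing Φ] [NonUnitalRing A] [Module Φ A]
    [NonUnitalRing Q] [Module Φ Q] (ι : A →ₙₐ[Φ] Q) : Prop where
  injective : Function.Injective ι
  exists_dense : ∀ q : Q, ∃ I : Submodule Φ A, IsDenseIdeal I ∧
    ∀ x ∈ I, q * ι x ∈ Set.range ι ∧ ι x * q ∈ Set.range ι
  eq_zero_of_mul_left : ∀ {I : Submodule Φ A}, IsDenseIdeal I →
    ∀ {q : Q}, (∀ x ∈ I, q * ι x = 0) → q = 0
  eq_zero_of_mul_right : ∀ {I : Submodule Φ A}, IsDenseIdeal I →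
    ∀ {q : Q}, (∀ x ∈ I, ι x * q = 0) → q = 0

namespace HasDenseDenominators

section DenseIdeals

open scoped Pointwise

attribute [local instance] commutatorLieRing

variable {Φ : Type*} [CommRing Φ] {A : Type*} [NonUnitalRing A] [Module Φ A]
  {Q : Type*} [NonUnitalRing Q] [Module Φ Q] {ι : A →ₙₐ[Φ] Q}

theorem eq_zero_of_add_self (h : HasDenseDenominators ι) (hA : ∀ a : A, a + a = 0 → a = 0)
    {q : Q} (hq : q + q = 0) : q = 0 := by
  obtain ⟨I, hI, hIq⟩ := h.exists_dense q
  refine h.eq_zero_of_mul_left hI fun x hx ↦ ?_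
  obtain ⟨a, ha⟩ := (hIq x hx).1
  have haa : a + a = 0 := h.injective (by rw [map_add, ha, ← add_mul, hq, zero_mul, map_zero])
  rw [← ha, hA a haa, map_zero]

variable [IsScalarTower Φ A A] [SMulCommClass Φ A A]

variable (Φ A) in
theorem id [SemiprimeAlgebra Φ A] : HasDenseDenominators (NonUnitalAlgHom.id Φ A) where
  injective := Function.injective_id
  exists_dense _ := ⟨⊤, isDenseIdeal_top, fun _ _ ↦ ⟨⟨_, rfl⟩, ⟨_, rfl⟩⟩⟩
  eq_zero_of_mul_left hI _ := hI.eq_zero_of_mul_left _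
  eq_zero_of_mul_right hI _ := hI.eq_zero_of_mul_right _

variable [IsScalarTower Φ Q Q] [SMulCommClass Φ Q Q] {K : Submodule Φ A} {p q : Q}

theorem exists_dense_le (h : HasDenseDenominators ι) (hK : IsDenseIdeal K) (q : Q) :
    ∃ I ≤ K, IsDenseIdeal I ∧ ∀ x ∈ I, q * ι x ∈ ι '' K ∧ ι x * q ∈ ι '' K := by
  obtain ⟨J, hJ, hJq⟩ := h.exists_dense q
  have hD := hK.inf hJ
  set D := K ⊓ J
  refine ⟨_, ?_, hD.span_mul hD, fun x hx ↦ ?_⟩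
  · rw [Submodule.span_le]
    rintro _ ⟨x, hx, y, -, rfl⟩
    exact hK.mul_mem_right y hx.1
  · let ιₗ : A →ₗ[Φ] Q := ι
    suffices hle : Submodule.span Φ ((D : Set A) * (D : Set A)) ≤
        (K.map ιₗ).comap (LinearMap.mulLeft Φ q ∘ₗ ιₗ) ⊓
          (K.map ιₗ).comap (LinearMap.mulRight Φ q ∘ₗ ιₗ) from hle hx
    rw [Submodule.span_le]
    rintro _ ⟨x, hx, y, hy, rfl⟩
    obtain ⟨a, ha⟩ := (hJq x hx.2).1
    obtain ⟨b, hb⟩ := (hJq y hy.2).2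
    exact ⟨⟨a * y, hK.mul_mem_left a hy.1, by simp [ιₗ, ha, mul_assoc]⟩,
      ⟨x * b, hK.mul_mem_right b hx.1, by simp [ιₗ, hb, mul_assoc]⟩⟩

theorem mem_center_of_lie_eq_zero (h : HasDenseDenominators ι) (hK : IsDenseIdeal K)
    (hp : ∀ x ∈ K, ⁅ι x, p⁆ = 0) : p ∈ Set.center Q := by
  refine mem_center_iff_lie_eq_zero.2 fun z ↦ ?_
  obtain ⟨I, hIK, hI, hIz⟩ := h.exists_dense_le hK z
  refine h.eq_zero_of_mul_right hI fun x hx ↦ ?_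
  obtain ⟨a, ha, hax⟩ := (hIz x hx).2
  have hxz : ⁅ι x * z, p⁆ = 0 := hax ▸ hp a ha
  rwa [mul_lie_leibniz, hp x (hIK hx), zero_mul, add_zero] at hxz

variable [SemiprimeAlgebra Φ A]

theorem map_mem_center (h : HasDenseDenominators ι) {x : A} :
    ι x ∈ Set.center Q ↔ x ∈ Set.center A := by
  refine ⟨fun hx ↦ mem_center_iff_lie_eq_zero.2 fun z ↦ h.injective ?_,
    fun hx ↦ h.mem_center_of_lie_eq_zero isDenseIdeal_top fun z _ ↦ ?_⟩
  · rw [map_commutator, mem_center_iff_lie_eq_zero.1 hx, map_zero]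
  · rw [← map_commutator, mem_center_iff_lie_eq_zero.1 hx, map_zero]

theorem eq_zero_of_mul_mul_self (h : HasDenseDenominators ι) (hK : IsDenseIdeal K)
    (hq : ∀ x ∈ K, q * ι x * q = 0) : q = 0 := by
  obtain ⟨I, hIK, hI, hIq⟩ := h.exists_dense_le hK q
  refine h.eq_zero_of_mul_left hI fun x hx ↦ ?_
  obtain ⟨b, -, hb⟩ := (hIq x hx).1
  have hbAb (a : A) : b * a * b = 0 := h.injective <| by
    rw [map_mul, map_mul, hb, map_zero, mul_assoc q, ← map_mul, ← mul_assoc,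
      hq _ (hK.mul_mem_right a (hIK hx)), zero_mul]
  rw [← hb, SemiprimeAlgebra.eq_zero_of_mul_mul_self (Φ := Φ) hbAb, map_zero]

theorem eq_zero_of_mem_center_of_mul_self_eq_zero (h : HasDenseDenominators ι)
    (hq : q ∈ Set.center Q) (hqq : q * q = 0) : q = 0 :=
  h.eq_zero_of_mul_mul_self isDenseIdeal_top fun x _ ↦ by
    rw [← Semigroup.mem_center_iff.1 hq, mul_assoc, hqq, mul_zero]

theorem mem_center_of_lie_lie_eq_zero (h : HasDenseDenominators ι) (hK : IsDenseIdeal K)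
    (hp : ∀ x ∈ K, ∀ y ∈ K, ⁅⁅ι x, ι y⁆, p⁆ = 0) : p ∈ Set.center Q := by
  obtain ⟨I, hIK, hI, hIp⟩ := h.exists_dense_le hK p
  have h_shift : ∀ x ∈ K, ∀ y ∈ I, ι y * ⁅⁅ι x, p⁆, p⁆ + ⁅ι y, p⁆ * ⁅ι x, p⁆ = 0 := by
    intro x hx y hy
    obtain ⟨a, ha, hay⟩ := (hIp y hy).2
    have hxyp : ⁅⁅ι x, ι y * p⁆, p⁆ = 0 := hay ▸ hp x hx a ha
    rwa [lie_mul_leibniz, add_lie, mul_lie_leibniz, mul_lie_leibniz, hp x hx y (hIK hy), lie_self,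
      mul_zero, zero_mul, zero_add, zero_add] at hxyp
  have h_sandwich : ∀ x ∈ K, ∀ y ∈ I, ⁅ι x, p⁆ * ι y * ⁅ι x, p⁆ = 0 := by
    intro x hx y hy
    have hxy := h_shift x hx (x * y) (hI.mul_mem_left x hy)
    rwa [map_mul, mul_lie_leibniz, add_mul, ← add_assoc, mul_assoc, mul_assoc, ← mul_add,
      h_shift x hx y hy, mul_zero, zero_add] at hxy
  exact h.mem_center_of_lie_eq_zero hI fun x hx ↦
    h.eq_zero_of_mul_mul_self hI fun y hy ↦ h_sandwich x (hIK hx) y hy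

theorem mem_center_of_lie_mem_center (h : HasDenseDenominators ι) (hK : IsDenseIdeal K)
    (hp : ∀ x ∈ K, ⁅ι x, p⁆ ∈ Set.center Q) : p ∈ Set.center Q :=
  h.mem_center_of_lie_lie_eq_zero hK fun x hx y hy ↦ by
    rw [lie_lie, mem_center_iff_lie_eq_zero.1 (hp y hy), mem_center_iff_lie_eq_zero.1 (hp x hx),
      sub_zero]

theorem mul_lie_eq_zero_of_mul_lie_mul_lie_eq_zero (h : HasDenseDenominators ι)
    (hK : IsDenseIdeal K) {c u : Q} (hc : c ∈ Set.center Q)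
    (hcu : ∀ x ∈ K, ∀ y ∈ K, c * ⁅u, ι x⁆ * ⁅u, ι y⁆ = 0) {x : A} (hx : x ∈ K) :
    c * ⁅u, ι x⁆ = 0 := by
  refine h.eq_zero_of_mul_mul_self hK fun y hy ↦ ?_
  have hyx : c * ⁅u, ι x⁆ * ι y * ⁅u, ι x⁆ = 0 := by
    have hyx' := hcu x hx (y * x) (hK.mul_mem_left y hx)
    rwa [map_mul, lie_mul_leibniz, mul_add, ← mul_assoc, hcu x hx y hy, zero_mul, zero_add,
      ← mul_assoc] at hyx'
  calc c * ⁅u, ι x⁆ * ι y * (c * ⁅u, ι x⁆) = c * ⁅u, ι x⁆ * ι y * (⁅u, ι x⁆ * c) := by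
        rw [Semigroup.mem_center_iff.1 hc]
    _ = 0 := by rw [← mul_assoc, hyx, zero_mul]

theorem mem_center_of_lie_lie_mem_center (h : HasDenseDenominators ι)
    (hA : ∀ a : A, a + a = 0 → a = 0) (hK : IsDenseIdeal K)
    (hp : ∀ x ∈ K, ∀ y ∈ K, ⁅⁅ι x, ι y⁆, p⁆ ∈ Set.center Q) : p ∈ Set.center Q := by
  refine h.mem_center_of_lie_lie_eq_zero hK fun a ha b hb ↦ ?_
  have hab : ⁅a, b⁆ ∈ K := K.sub_mem (hK.mul_mem_left a hb) (hK.mul_mem_left b ha)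
  have hc := hp a ha b hb
  rw [← map_commutator] at hc ⊢
  set u := ι ⁅a, b⁆
  set c := ⁅u, p⁆
  have h_second : ∀ x ∈ K, c * ⁅u, ⁅u, ι x⁆⁆ = 0 := fun x hx ↦
    have h_lie (y : A) (hy : y ∈ K) : ⁅u, ⁅⁅u, ι y⁆, p⁆⁆ = 0 :=
      mem_center_iff_lie_eq_zero.1 (hp _ hab y hy) u
    lie_mul_lie_lie_eq_zero hc (h_lie x hx) (map_mul ι _ x ▸ h_lie _ (hK.mul_mem_left _ hx))
  have h_first : ∀ x ∈ K, c * ⁅u, ι x⁆ = 0 := fun x hx ↦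
    h.mul_lie_eq_zero_of_mul_lie_mul_lie_eq_zero hK hc (fun x hx y hy ↦
      h.eq_zero_of_add_self hA <| add_self_mul_lie_mul_lie_eq_zero hc (h_second x hx)
        (h_second y hy) (map_mul ι x y ▸ h_second _ (hK.mul_mem_left x hy))) hx
  have hcu : c * u ∈ Set.center Q := h.mem_center_of_lie_eq_zero hK fun x hx ↦ by
    rw [← lie_skew, mul_lie_leibniz, h_first x hx, ← lie_skew, mem_center_iff_lie_eq_zero.1 hc,
      neg_zero, zero_mul, add_zero, neg_zero]
  refine h.eq_zero_of_mem_center_of_mul_self_eq_zero hc ?_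
  have hpcu := mem_center_iff_lie_eq_zero.1 hcu p
  rwa [lie_mul_leibniz, mem_center_iff_lie_eq_zero.1 hc, zero_mul, zero_add, ← lie_skew, mul_neg,
    neg_eq_zero] at hpcu

end DenseIdeals

end HasDenseDenominators

/-! ### Subalgebras of the symmetric Martindale algebra of quotients -/

namespace SymmetricQuotients

open PartialMultiplier

variable {Φ : Type*} [CommRing Φ] {A : Type*} [NonUnitalRing A] [Module Φ A]

/-- The element of `Q_s(A)` represented by a partial multiplier. -/
def mk (p : PartialMultiplier Φ A) : SymmetricQuotients Φ A := Quotient.mk _ p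

theorem mk_surjective : Function.Surjective (mk : PartialMultiplier Φ A → _) :=
  Quotient.mk_surjective

variable [IsScalarTower Φ A A] [SMulCommClass Φ A A] [SemiprimeAlgebra Φ A]

variable (Φ A) in
theorem incl_injective : Function.Injective (incl Φ A) := fun a b hab ↦
  sub_eq_zero.1 <| (isDenseIdeal_top (Φ := Φ)).eq_zero_of_mul_left _ fun x _ ↦ by
    rw [sub_mul, sub_eq_zero]
    exact (Quotient.exact hab x trivial trivial).1

theorem mk_mul_incl (p : PartialMultiplier Φ A) (x : p.dom) :
    mk p * incl Φ A x = incl Φ A (p.left x) :=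
  Quotient.sound fun y hy _ ↦ ⟨p.left_mul x y, (p.balanced ⟨y, hy.1⟩ x).symm⟩

theorem incl_mul_mk (p : PartialMultiplier Φ A) (x : p.dom) :
    incl Φ A x * mk p = incl Φ A (p.right x) :=
  Quotient.sound fun y hy _ ↦ ⟨p.balanced x ⟨y, hy.2.1⟩, p.right_mul y x⟩

theorem mk_eq_zero {p : PartialMultiplier Φ A} (hl : ∀ x, p.left x = 0)
    (hr : ∀ x, p.right x = 0) : mk p = 0 :=
  Quotient.sound fun x hx _ ↦ ⟨(hl ⟨x, hx⟩).trans (zero_mul x).symm,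
    (hr ⟨x, hx⟩).trans (mul_zero x).symm⟩

theorem eq_zero_of_mul_incl {I : Submodule Φ A} (hI : IsDenseIdeal I)
    {q : SymmetricQuotients Φ A} (hq : ∀ x ∈ I, q * incl Φ A x = 0) : q = 0 := by
  obtain ⟨p, rfl⟩ := mk_surjective q
  have hJ := p.dense.inf hI
  have h_left (x : A) (hx : x ∈ p.dom ⊓ I) : p.left ⟨x, hx.1⟩ = 0 := incl_injective Φ A <| by
    rw [← mk_mul_incl p, hq x hx.2, map_zero]
  refine mk_eq_zero (fun y ↦ hJ.eq_zero_of_mul_left _ fun x hx ↦ ?_)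
    fun y ↦ hJ.eq_zero_of_mul_left _ fun x hx ↦ ?_
  · rw [← p.left_mul]
    exact h_left _ (hJ.mul_mem_left _ hx)
  · rw [← p.balanced y ⟨x, hx.1⟩, h_left x hx, mul_zero]

theorem eq_zero_of_incl_mul {I : Submodule Φ A} (hI : IsDenseIdeal I)
    {q : SymmetricQuotients Φ A} (hq : ∀ x ∈ I, incl Φ A x * q = 0) : q = 0 := by
  obtain ⟨p, rfl⟩ := mk_surjective q
  have hJ := p.dense.inf hI
  have h_right (x : A) (hx : x ∈ p.dom ⊓ I) : p.right ⟨x, hx.1⟩ = 0 := incl_injective Φ A <| by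
    rw [← incl_mul_mk p, hq x hx.2, map_zero]
  refine mk_eq_zero (fun y ↦ hJ.eq_zero_of_mul_right _ fun x hx ↦ ?_)
    fun y ↦ hJ.eq_zero_of_mul_right _ fun x hx ↦ ?_
  · rw [p.balanced ⟨x, hx.1⟩ y, h_right x hx, zero_mul]
  · rw [← p.right_mul]
    exact h_right _ (hJ.mul_mem_right _ hx)

theorem hasDenseDenominators (Q : NonUnitalSubalgebra Φ (SymmetricQuotients Φ A))
    (hAQ : ∀ a : A, incl Φ A a ∈ Q) :
    HasDenseDenominators (NonUnitalAlgHom.codRestrict (incl Φ A) Q hAQ) where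
  injective _ _ hab := incl_injective Φ A (congrArg Subtype.val hab)
  exists_dense := by
    rintro ⟨q, hq⟩
    obtain ⟨p, rfl⟩ := mk_surjective q
    exact ⟨p.dom, p.dense, fun x hx ↦
      ⟨⟨p.left ⟨x, hx⟩, Subtype.ext (mk_mul_incl p ⟨x, hx⟩).symm⟩,
        ⟨p.right ⟨x, hx⟩, Subtype.ext (incl_mul_mk p ⟨x, hx⟩).symm⟩⟩⟩
  eq_zero_of_mul_left hI _ hq :=
    Subtype.ext (eq_zero_of_mul_incl hI fun x hx ↦ congrArg Subtype.val (hq x hx))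
  eq_zero_of_mul_right hI _ hq :=
    Subtype.ext (eq_zero_of_incl_mul hI fun x hx ↦ congrArg Subtype.val (hq x hx))

end SymmetricQuotients

/-! ### Graded modules -/

section GradedModule

open DirectSum

variable {G : Type*} [DecidableEq G] {R : Type*} [Ring R]
  {L : Type*} [AddCommGroup L] [Module R L] {M : Type*} [AddCommGroup M] [Module R M]
  {𝓛 : G → Submodule R L} [Decomposition 𝓛]

theorem isHomogeneous_span {s : Set L} (hs : ∀ x ∈ s, SetLike.IsHomogeneousElem 𝓛 x) :
    SetLike.IsHomogeneous 𝓛 (Submodule.span R s) := fun σ x hx ↦ by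
  induction hx using Submodule.span_induction with
  | mem x hx =>
    obtain ⟨τ, hτ⟩ := hs x hx
    rw [decompose_of_mem 𝓛 hτ, coe_of_apply]
    split_ifs
    exacts [Submodule.subset_span hx, zero_mem _]
  | zero => simp
  | add x y _ _ ihx ihy => simpa using add_mem ihx ihy
  | smul c x _ ih =>
    rw [decompose_smul]
    exact Submodule.smul_mem _ c ih

/-- The submodule spanned by the homogeneous components of the elements of `N`: the smallest
homogeneous submodule containing `N`. -/
def homogeneousHull (𝓛 : G → Submodule R L) [Decomposition 𝓛] (N : Submodule R L) :
    Submodule R L :=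
  Submodule.span R {x | ∃ y ∈ N, ∃ σ, (decompose 𝓛 y σ : L) = x}

theorem isHomogeneous_homogeneousHull (N : Submodule R L) :
    SetLike.IsHomogeneous 𝓛 (homogeneousHull 𝓛 N) := by
  refine isHomogeneous_span ?_
  rintro _ ⟨y, -, σ, rfl⟩
  exact ⟨σ, Subtype.mem _⟩

theorem le_homogeneousHull (N : Submodule R L) : N ≤ homogeneousHull 𝓛 N := fun x hx ↦
  (AddSubmonoidClass.IsHomogeneous.mem_iff 𝓛 _ (isHomogeneous_homogeneousHull N)).2
    fun σ ↦ Submodule.subset_span ⟨x, hx, σ, rfl⟩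

theorem homogeneousHull_le {N P : Submodule R L} (hNP : N ≤ P) (hP : SetLike.IsHomogeneous 𝓛 P) :
    homogeneousHull 𝓛 N ≤ P := by
  refine Submodule.span_le.2 ?_
  rintro _ ⟨y, hy, σ, rfl⟩
  exact hP σ (hNP hy)

theorem exists_homogeneous_map_notMem {N : Submodule R L} {P : Submodule R M} {f : L →ₗ[R] M}
    (hN : SetLike.IsHomogeneous 𝓛 N) (hfN : ∃ x ∈ N, f x ∉ P) :
    ∃ σ, ∃ x ∈ 𝓛 σ, x ∈ N ∧ f x ∉ P := by
  classical
  obtain ⟨x, hx, hfx⟩ := hfN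
  contrapose! hfx
  rw [← sum_support_decompose 𝓛 x, map_sum]
  exact sum_mem fun σ _ ↦ hfx σ _ (Subtype.mem _) (hN σ hx)

theorem isInternal_comap_subtype {N : Submodule R L} (hN : SetLike.IsHomogeneous 𝓛 N) :
    IsInternal fun σ ↦ (𝓛 σ).comap N.subtype := by
  refine isInternal_submodule_of_iSupIndep_of_iSup_eq_top (fun σ ↦ ?_) ?_
  · have hσ := (Decomposition.isInternal 𝓛).submodule_iSupIndep σ
    rw [Submodule.disjoint_def] at hσ ⊢
    refine fun x hx hx' ↦ Subtype.ext (hσ x hx ?_)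
    have := Submodule.mem_map_of_mem (f := N.subtype) hx'
    simp only [Submodule.map_iSup] at this
    exact iSup₂_mono (fun τ _ ↦ Submodule.map_comap_le _ _) this
  · classical
    refine eq_top_iff.2 fun x _ ↦ ?_
    have : x = ∑ σ ∈ (decompose 𝓛 (x : L)).support, ⟨decompose 𝓛 (x : L) σ, hN σ x.2⟩ :=
      Subtype.ext (by simp [sum_support_decompose])
    rw [this]
    exact sum_mem fun σ _ ↦ Submodule.mem_iSup_of_mem σ (decompose 𝓛 (x : L) σ).2

theorem isInternal_map {f : L →ₗ[R] M} (hf : Function.Surjective f)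
    (hker : SetLike.IsHomogeneous 𝓛 (LinearMap.ker f)) : IsInternal fun σ ↦ (𝓛 σ).map f := by
  refine isInternal_submodule_of_iSupIndep_of_iSup_eq_top (fun σ ↦ ?_) ?_
  · rw [Submodule.disjoint_def]
    rintro _ ⟨x, hx, rfl⟩ hx'
    simp only [← Submodule.map_iSup] at hx'
    obtain ⟨y, hy, hyx⟩ := hx'
    have hyσ : (decompose 𝓛 y σ : L) = 0 := by
      let proj : L →ₗ[R] 𝓛 σ := component R G (fun τ ↦ 𝓛 τ) σ ∘ₗ decomposeLinearEquiv 𝓛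
      have hle : ⨆ τ, ⨆ _ : τ ≠ σ, 𝓛 τ ≤ LinearMap.ker proj :=
        iSup₂_le fun τ hτ z hz ↦ Subtype.ext (decompose_of_mem_ne 𝓛 hz hτ)
      exact congrArg Subtype.val (hle hy)
    have hx_ker := hker σ (LinearMap.sub_mem_ker_iff.2 hyx.symm)
    rwa [decompose_sub, DirectSum.sub_apply, AddSubgroupClass.coe_sub,
      decompose_of_mem_same 𝓛 hx, hyσ, sub_zero] at hx_ker
  · rw [← Submodule.map_iSup, (Decomposition.isInternal 𝓛).submodule_iSup_eq_top,
      Submodule.map_top, LinearMap.range_eq_top.2 hf]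

section GradedMap

variable {H : Type*} [DecidableEq H] {𝓜 : H → Submodule R M} [Decomposition 𝓜] {f : L →ₗ[R] M}
  {e : G → H}

theorem decompose_map_apply (he : Function.Injective e) (hf : ∀ σ, ∀ x ∈ 𝓛 σ, f x ∈ 𝓜 (e σ))
    (x : L) (σ : G) : (decompose 𝓜 (f x) (e σ) : M) = f (decompose 𝓛 x σ) := by
  induction x using Decomposition.inductionOn 𝓛 with
  | zero => simp
  | @homogeneous τ x =>
    rw [decompose_of_mem 𝓜 (hf τ x x.2), decompose_coe, coe_of_apply, coe_of_apply]
    simp only [he.eq_iff]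
    split_ifs <;> simp
  | add x y ihx ihy => simp [ihx, ihy]

theorem isHomogeneous_comap (he : Function.Injective e) (hf : ∀ σ, ∀ x ∈ 𝓛 σ, f x ∈ 𝓜 (e σ))
    {N : Submodule R M} (hN : SetLike.IsHomogeneous 𝓜 N) :
    SetLike.IsHomogeneous 𝓛 (N.comap f) := fun σ x hx ↦ by
  rw [Submodule.mem_comap, ← decompose_map_apply he hf]
  exact hN (e σ) hx

end GradedMap

theorem isHomogeneous_range {𝓜 : G → Submodule R M} [Decomposition 𝓜] {f : L →ₗ[R] M}
    (hf : ∀ σ, ∀ x ∈ 𝓛 σ, f x ∈ 𝓜 σ) : SetLike.IsHomogeneous 𝓜 (LinearMap.range f) := by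
  rintro σ _ ⟨x, rfl⟩
  exact ⟨_, (decompose_map_apply Function.injective_id hf x σ).symm⟩

end GradedModule

section GradedDenseIdeals

open DirectSum

variable {Φ : Type*} [CommRing Φ] {A : Type*} [NonUnitalRing A] [Module Φ A]
  {I J : Submodule Φ A}

theorem IsDenseIdeal.of_le (hI : IsDenseIdeal I) (hIJ : I ≤ J) (hJ : IsTwoSidedIdeal J) :
    IsDenseIdeal J where
  toIsTwoSidedIdeal := hJ
  eq_zero_of_mul_left z hz := hI.eq_zero_of_mul_left z fun x hx ↦ hz x (hIJ hx)
  eq_zero_of_mul_right z hz := hI.eq_zero_of_mul_right z fun x hx ↦ hz x (hIJ hx)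

variable [IsScalarTower Φ A A] [SMulCommClass Φ A A] {G : Type*} [Add G] [IsCancelAdd G]
  [DecidableEq G] {𝒜 : G → Submodule Φ A} [Decomposition 𝒜] [SetLike.GradedMul 𝒜]

theorem IsTwoSidedIdeal.homogeneousHull (hI : IsTwoSidedIdeal I) :
    IsTwoSidedIdeal (homogeneousHull 𝒜 I) := by
  refine .span ?_ ?_ <;> rintro a _ ⟨x, hx, σ, rfl⟩ <;>
    induction a using Decomposition.inductionOn 𝒜 with
    | zero => simp
    | add a b iha ihb => simpa only [add_mul, mul_add] using add_mem iha ihb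
    | @homogeneous τ a => ?_
  · exact Submodule.subset_span ⟨a * x, hI.mul_mem_left a hx, τ + σ,
      decompose_map_apply (f := LinearMap.mulLeft Φ (a : A)) (add_right_injective τ)
        (fun _ _ ↦ SetLike.GradedMul.mul_mem a.2) x σ⟩
  · exact Submodule.subset_span ⟨x * a, hI.mul_mem_right a hx, σ + τ,
      decompose_map_apply (f := LinearMap.mulRight Φ (a : A)) (add_left_injective τ)
        (fun _ _ hy ↦ SetLike.GradedMul.mul_mem hy a.2) x σ⟩

theorem IsDenseIdeal.homogeneousHull (hI : IsDenseIdeal I) :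
    IsDenseIdeal (homogeneousHull 𝒜 I) :=
  hI.of_le (le_homogeneousHull I) hI.toIsTwoSidedIdeal.homogeneousHull

end GradedDenseIdeals

/-! ### Graded Lie algebras -/

section GradedLieAlgebras

open DirectSum

variable {G : Type*} [AddCommGroup G] [DecidableEq G] {Φ : Type*} [CommRing Φ]
  {L : Type*} [LieRing L] [LieAlgebra Φ L] {𝓛 : G → Submodule Φ L} [GradedLieAlgebra 𝓛]

variable (𝓛) in
theorem isLieGrading : IsLieGrading 𝓛 := ⟨Decomposition.isInternal 𝓛, inferInstance⟩

theorem decompose_lie_of_mem {τ : G} {x : L} (hx : x ∈ 𝓛 τ) (y : L) (σ : G) :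
    (decompose 𝓛 ⁅x, y⁆ (τ + σ) : L) = ⁅x, (decompose 𝓛 y σ : L)⁆ :=
  decompose_map_apply (f := (LieAlgebra.ad Φ L x : L →ₗ[Φ] L)) (add_right_injective τ)
    (fun _ _ ↦ SetLike.GradedBracket.bracket_mem hx) y σ

theorem isHomogeneous_center : SetLike.IsHomogeneous 𝓛 (LieAlgebra.center Φ L).toSubmodule := by
  refine fun σ x hx ↦ (LieModule.mem_maxTrivSubmodule Φ L L _).2 fun y ↦ ?_
  induction y using Decomposition.inductionOn 𝓛 with
  | zero => exact zero_lie _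
  | homogeneous y =>
    rw [← decompose_lie_of_mem y.2, (LieModule.mem_maxTrivSubmodule Φ L L x).1 hx, decompose_zero,
      DirectSum.zero_apply, ZeroMemClass.coe_zero]
  | add y z ihy ihz => rw [add_lie, ihy, ihz, add_zero]

theorem isHomogeneous_lie {I J : LieIdeal Φ L} (hI : SetLike.IsHomogeneous 𝓛 I.toSubmodule)
    (hJ : SetLike.IsHomogeneous 𝓛 J.toSubmodule) :
    SetLike.IsHomogeneous 𝓛 (⁅I, J⁆ : LieIdeal Φ L).toSubmodule := by
  classical
  let s : Set L := {z | SetLike.IsHomogeneousElem 𝓛 z ∧ ∃ x ∈ I, ∃ y ∈ J, ⁅x, y⁆ = z}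
  suffices h_span : (⁅I, J⁆ : LieIdeal Φ L).toSubmodule = Submodule.span Φ s from
    h_span ▸ isHomogeneous_span fun z hz ↦ hz.1
  rw [LieSubmodule.lieIdeal_oper_eq_linear_span']
  refine le_antisymm (Submodule.span_le.2 ?_) (Submodule.span_mono fun z hz ↦ hz.2)
  rintro _ ⟨x, hx, y, hy, rfl⟩
  rw [← sum_support_decompose 𝓛 x, ← sum_support_decompose 𝓛 y, sum_lie_sum]
  exact sum_mem fun σ _ ↦ sum_mem fun τ _ ↦ Submodule.subset_span
    ⟨⟨σ + τ, SetLike.GradedBracket.bracket_mem (Subtype.mem _) (Subtype.mem _)⟩,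
      _, hI σ hx, _, hJ τ hy, rfl⟩

noncomputable instance : GradedLieAlgebra (derivedGrading 𝓛) where
  __ := (isInternal_comap_subtype (isHomogeneous_lie (I := ⊤) (J := ⊤) (𝓛 := 𝓛)
    (fun _ _ _ ↦ trivial) fun _ _ _ ↦ trivial)).chooseDecomposition
  bracket_mem _ _ _ _ hx hy := SetLike.GradedBracket.bracket_mem (ℒ := 𝓛) hx hy

theorem toModCenter_surjective : Function.Surjective (toModCenter Φ L) :=
  LieSubmodule.Quotient.surjective_mk' _

theorem toModCenter_eq_zero {x : L} : toModCenter Φ L x = 0 ↔ x ∈ LieAlgebra.center Φ L :=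
  LieSubmodule.Quotient.mk_eq_zero'

theorem toModCenter_lie (x y : L) :
    toModCenter Φ L ⁅x, y⁆ = ⁅toModCenter Φ L x, toModCenter Φ L y⁆ :=
  LieSubmodule.Quotient.mk_bracket _ x y

noncomputable instance : GradedLieAlgebra (modCenterGrading 𝓛) where
  __ := (isInternal_map (𝓛 := 𝓛) (toModCenter_surjective (Φ := Φ) (L := L))
    ((Submodule.ker_mkQ (LieAlgebra.center Φ L).toSubmodule).symm ▸
      isHomogeneous_center)).chooseDecomposition
  bracket_mem := by
    rintro σ τ _ _ ⟨x, hx, rfl⟩ ⟨y, hy, rfl⟩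
    exact ⟨⁅x, y⁆, SetLike.GradedBracket.bracket_mem hx hy, toModCenter_lie x y⟩

variable {M : Type*} [LieRing M] [LieAlgebra Φ M]

/-- The homomorphism `L / Z_L → M / Z_M` induced by a homomorphism `L → M` that maps `Z_L` into
`Z_M`. -/
def modCenterMap (φ : L →ₗ⁅Φ⁆ M) (hφ : ∀ x ∈ LieAlgebra.center Φ L, φ x ∈ LieAlgebra.center Φ M) :
    ModCenter Φ L →ₗ⁅Φ⁆ ModCenter Φ M where
  toLinearMap := Submodule.mapQ (LieAlgebra.center Φ L).toSubmodule
    (LieAlgebra.center Φ M).toSubmodule (φ : L →ₗ[Φ] M) hφ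
  map_lie' {x y} := by
    obtain ⟨x, rfl⟩ := toModCenter_surjective (Φ := Φ) x
    obtain ⟨y, rfl⟩ := toModCenter_surjective (Φ := Φ) y
    exact (congrArg (toModCenter Φ M) (φ.map_lie x y)).trans (toModCenter_lie _ _)

theorem modCenterMap_toModCenter (φ : L →ₗ⁅Φ⁆ M)
    (hφ : ∀ x ∈ LieAlgebra.center Φ L, φ x ∈ LieAlgebra.center Φ M) (x : L) :
    modCenterMap φ hφ (toModCenter Φ L x) = toModCenter Φ M (φ x) :=
  rfl

theorem adSpan_modCenterMap_le (φ : L →ₗ⁅Φ⁆ M)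
    (hφ : ∀ x ∈ LieAlgebra.center Φ L, φ x ∈ LieAlgebra.center Φ M) (q : M) :
    adSpan (modCenterMap φ hφ) (toModCenter Φ M q) ≤ (adSpan φ q).map (toModCenter Φ M) := by
  refine Submodule.span_le.2 ?_
  rintro _ ⟨l, rfl⟩
  obtain ⟨l, rfl⟩ := List.map_surjective_iff.2 (toModCenter_surjective (Φ := Φ)) l
  refine ⟨_, Submodule.subset_span ⟨l, rfl⟩, ?_⟩
  rw [List.foldr_map]
  exact (List.foldr_hom (toModCenter Φ M) fun x m ↦ (toModCenter_lie (φ x) m).symm).symm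

theorem lie_adSpan_mem_range {φ : L →ₗ⁅Φ⁆ M} {U : LieIdeal Φ L} {q m : M}
    (hq : ∀ x ∈ U, ⁅φ x, q⁆ ∈ φ.range) (hm : m ∈ adSpan φ q) {x : L} (hx : x ∈ U) :
    ⁅φ x, m⁆ ∈ φ.range := by
  suffices hle : adSpan φ q ≤ φ.range.toSubmodule.comap (LieAlgebra.ad Φ M (φ x)) from hle hm
  refine Submodule.span_le.2 ?_
  rintro _ ⟨l, rfl⟩
  change ⁅φ x, _⁆ ∈ φ.range
  induction l generalizing x with
  | nil => exact hq x hx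
  | cons y l ih =>
    rw [List.foldr_cons, leibniz_lie, ← LieHom.map_lie]
    exact add_mem (ih (lie_mem_left Φ L U x y hx)) (φ.range.lie_mem ⟨y, rfl⟩ (ih hx))

theorem isGradedAlgebraOfQuotients_modCenterMap {𝓜 : G → Submodule Φ M} [GradedLieAlgebra 𝓜]
    {φ : L →ₗ⁅Φ⁆ M} (hφ : ∀ x, φ x ∈ LieAlgebra.center Φ M ↔ x ∈ LieAlgebra.center Φ L)
    (hφ_mem : ∀ σ, ∀ x ∈ 𝓛 σ, φ x ∈ 𝓜 σ)
    (hφ_absorb : ∀ τ, ∀ q ∈ 𝓜 τ, ∃ U : LieIdeal Φ L, SetLike.IsHomogeneous 𝓛 U.toSubmodule ∧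
      (∀ x ∈ U, ⁅φ x, q⁆ ∈ φ.range) ∧
      ∀ p, (∀ x ∈ U, ⁅φ x, p⁆ ∈ LieAlgebra.center Φ M) → p ∈ LieAlgebra.center Φ M) :
    IsGradedAlgebraOfQuotients (modCenterGrading 𝓛) (modCenterGrading 𝓜)
      (modCenterMap φ fun x ↦ (hφ x).2) where
  grading_sub := isLieGrading _
  grading := isLieGrading _
  injective := by
    refine (injective_iff_map_eq_zero _).2 (toModCenter_surjective.forall.2 fun x hx ↦ ?_)
    rwa [modCenterMap_toModCenter, toModCenter_eq_zero, hφ, ← toModCenter_eq_zero] at hx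
  map_mem := by
    rintro σ _ ⟨x, hx, rfl⟩
    exact ⟨φ x, hφ_mem σ x hx, rfl⟩
  absorb := by
    rintro σ τ _ ⟨p, -, rfl⟩ hp _ ⟨q, hq, rfl⟩
    obtain ⟨U, hU, hUq, hUp⟩ := hφ_absorb τ q hq
    have hp' : ∃ x ∈ U, ⁅φ x, p⁆ ∉ LieAlgebra.center Φ M := by
      contrapose! hp
      exact toModCenter_eq_zero.2 (hUp p hp)
    obtain ⟨α, x, hxα, hxU, hxp⟩ := exists_homogeneous_map_notMem
      (f := (LieModule.toEnd Φ M M : M →ₗ[Φ] Module.End Φ M).flip p ∘ₗ (φ : L →ₗ[Φ] M)) hU hp'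
    refine ⟨α, toModCenter Φ L x, ⟨x, hxα, rfl⟩, ?_, fun m hm ↦ ?_⟩
    · rwa [modCenterMap_toModCenter, ← toModCenter_lie, Ne, toModCenter_eq_zero]
    · obtain ⟨m, hm', rfl⟩ := adSpan_modCenterMap_le φ _ q hm
      obtain ⟨y, hy⟩ := lie_adSpan_mem_range hUq hm' hxU
      exact ⟨toModCenter Φ L y, (congrArg (toModCenter Φ M) hy).trans (toModCenter_lie (φ x) m)⟩

end GradedLieAlgebras

section DerivedIdeal

variable {Φ : Type*} [CommRing Φ] {L M : Type*} [LieRing L] [LieAlgebra Φ L] [LieRing M]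
  [LieAlgebra Φ M]

theorem lie_mem_derivedIdeal (x y : L) : ⁅x, y⁆ ∈ derivedIdeal Φ L :=
  LieSubmodule.lie_mem_lie trivial trivial

theorem map_mem_derivedIdeal (φ : L →ₗ⁅Φ⁆ M) {x : L} (hx : x ∈ derivedIdeal Φ L) :
    φ x ∈ derivedIdeal Φ M :=
  LieSubmodule.mono_lie le_top le_top (LieIdeal.map_bracket_le φ (LieIdeal.mem_map hx))

/-- The homomorphism `[L, L] → [M, M]` obtained by restricting a homomorphism `L → M`. -/
def derivedMap (φ : L →ₗ⁅Φ⁆ M) : derivedIdeal Φ L →ₗ⁅Φ⁆ derivedIdeal Φ M where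
  toLinearMap := (φ : L →ₗ[Φ] M).restrict fun _ ↦ map_mem_derivedIdeal φ
  map_lie' {x y} := Subtype.ext (φ.map_lie x y)

theorem exists_mem_derivedIdeal_map_eq_lie {φ : L →ₗ⁅Φ⁆ M} {I : LieIdeal Φ L} {q : M}
    (hq : ∀ x ∈ I, ⁅φ x, q⁆ ∈ φ.range) {x : L} (hx : x ∈ ⁅I, I⁆) :
    ∃ y ∈ derivedIdeal Φ L, φ y = ⁅φ x, q⁆ := by
  suffices hle : (⁅I, I⁆ : LieIdeal Φ L).toSubmodule ≤
      ((derivedIdeal Φ L).toSubmodule.map (φ : L →ₗ[Φ] M)).comap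
        ((LieModule.toEnd Φ M M).flip q ∘ₗ (φ : L →ₗ[Φ] M)) from hle hx
  rw [LieSubmodule.lieIdeal_oper_eq_linear_span', Submodule.span_le]
  rintro _ ⟨a, ha, b, hb, rfl⟩
  obtain ⟨a', ha'⟩ := hq a ha
  obtain ⟨b', hb'⟩ := hq b hb
  refine ⟨⁅a, b'⁆ - ⁅b, a'⁆, sub_mem (lie_mem_derivedIdeal a b') (lie_mem_derivedIdeal b a'), ?_⟩
  change φ (⁅a, b'⁆ - ⁅b, a'⁆) = ⁅φ ⁅a, b⁆, q⁆
  rw [LieHom.coe_toLinearMap] at ha' hb'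
  rw [map_sub, LieHom.map_lie, LieHom.map_lie, LieHom.map_lie, ha', hb', lie_lie]

end DerivedIdeal

/-! ### The Lie algebra of a graded associative algebra -/

section MinusAlgebras

open DirectSum

variable {Φ : Type*} [CommRing Φ] {A : Type*} [NonUnitalRing A] [Module Φ A]
  [IsScalarTower Φ A A] [SMulCommClass Φ A A]
  {Q : Type*} [NonUnitalRing Q] [Module Φ Q] [IsScalarTower Φ Q Q] [SMulCommClass Φ Q Q]

theorem MinusAlgebra.of_mem_center {x : A} :
    of Φ x ∈ LieAlgebra.center Φ (MinusAlgebra A) ↔ x ∈ Set.center A :=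
  (LieModule.mem_maxTrivSubmodule Φ (MinusAlgebra A) (MinusAlgebra A) (of Φ x)).trans
    (mem_center_iff_lie_eq_zero (R := A)).symm

/-- The homomorphism `A⁻ → Q⁻` given by a homomorphism `A → Q` of associative algebras. -/
def minusMap (ι : A →ₙₐ[Φ] Q) : MinusAlgebra A →ₗ⁅Φ⁆ MinusAlgebra Q where
  toLinearMap := (ι : A →ₗ[Φ] Q)
  map_lie' {x y} := map_commutator (R := A) (S := Q) ι x y

/-- A two-sided ideal of `A`, viewed as an ideal of the Lie algebra `A⁻`. -/
def IsTwoSidedIdeal.toLieIdeal {I : Submodule Φ A} (hI : IsTwoSidedIdeal I) :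
    LieIdeal Φ (MinusAlgebra A) where
  __ := I.map (MinusAlgebra.of Φ : A ≃ₗ[Φ] MinusAlgebra A).toLinearMap
  lie_mem := by
    rintro (x : A) _ ⟨y, hy, rfl⟩
    exact ⟨x * y - y * x, I.sub_mem (hI.mul_mem_left x hy) (hI.mul_mem_right x hy), rfl⟩

variable {G : Type*} [AddCommGroup G] [DecidableEq G] {𝒜 : G → Submodule Φ A} [Decomposition 𝒜]

noncomputable instance [SetLike.GradedMul 𝒜] : GradedLieAlgebra (minusGrading 𝒜) where
  __ := (isInternal_map (𝓛 := 𝒜) (MinusAlgebra.of Φ : A ≃ₗ[Φ] MinusAlgebra A).surjective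
    fun σ x (hx : x = 0) ↦ by simp [hx]).chooseDecomposition
  bracket_mem := by
    rintro σ τ _ _ ⟨x, hx, rfl⟩ ⟨y, hy, rfl⟩
    exact ⟨x * y - y * x, sub_mem (SetLike.GradedMul.mul_mem hx hy)
      (add_comm τ σ ▸ SetLike.GradedMul.mul_mem hy hx), rfl⟩

theorem IsTwoSidedIdeal.isHomogeneous_toLieIdeal [SetLike.GradedMul 𝒜] {I : Submodule Φ A}
    (hI : IsTwoSidedIdeal I) (hI' : SetLike.IsHomogeneous 𝒜 I) :
    SetLike.IsHomogeneous (minusGrading 𝒜) hI.toLieIdeal.toSubmodule := by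
  rintro σ _ ⟨x, hx, rfl⟩
  exact ⟨_, hI' σ hx, (decompose_map_apply (𝓛 := 𝒜) (𝓜 := minusGrading 𝒜) (e := id)
    Function.injective_id (fun τ y hy ↦ Submodule.mem_map_of_mem hy) x σ).symm⟩

end MinusAlgebras

/-! ### Graded Lie algebras of algebras of quotients -/

namespace HasDenseDenominators

open DirectSum

variable {Φ : Type*} [CommRing Φ] {A : Type*} [NonUnitalRing A] [Module Φ A]
  [IsScalarTower Φ A A] [SMulCommClass Φ A A]
  {Q : Type*} [NonUnitalRing Q] [Module Φ Q] [IsScalarTower Φ Q Q] [SMulCommClass Φ Q Q]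
  {ι : A →ₙₐ[Φ] Q}

section Graded

variable {G : Type*} [Add G] [IsCancelAdd G] [DecidableEq G]
  {𝒜 : G → Submodule Φ A} [Decomposition 𝒜] [SetLike.GradedMul 𝒜]
  {𝒬 : G → Submodule Φ Q} [Decomposition 𝒬] [SetLike.GradedMul 𝒬]

theorem exists_homogeneous_dense (h : HasDenseDenominators ι) (hι : ∀ σ, ∀ a ∈ 𝒜 σ, ι a ∈ 𝒬 σ)
    {τ : G} {q : Q} (hq : q ∈ 𝒬 τ) :
    ∃ I : Submodule Φ A, IsDenseIdeal I ∧ SetLike.IsHomogeneous 𝒜 I ∧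
      ∀ x ∈ I, q * ι x ∈ Set.range ι ∧ ι x * q ∈ Set.range ι := by
  obtain ⟨I, hI, hIq⟩ := h.exists_dense q
  let ιₗ : A →ₗ[Φ] Q := ι
  have h_range : SetLike.IsHomogeneous 𝒬 (LinearMap.range ιₗ) := isHomogeneous_range hι
  have h_left : homogeneousHull 𝒜 I ≤ (LinearMap.range ιₗ).comap (LinearMap.mulLeft Φ q ∘ₗ ιₗ) :=
    homogeneousHull_le (fun x hx ↦ (hIq x hx).1) <| isHomogeneous_comap (add_right_injective τ)
      (fun σ x hx ↦ SetLike.GradedMul.mul_mem hq (hι σ x hx)) h_range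
  have h_right : homogeneousHull 𝒜 I ≤ (LinearMap.range ιₗ).comap (LinearMap.mulRight Φ q ∘ₗ ιₗ) :=
    homogeneousHull_le (fun x hx ↦ (hIq x hx).2) <| isHomogeneous_comap (add_left_injective τ)
      (fun σ x hx ↦ SetLike.GradedMul.mul_mem (hι σ x hx) hq) h_range
  exact ⟨_, hI.homogeneousHull, isHomogeneous_homogeneousHull I,
    fun x hx ↦ ⟨h_left hx, h_right hx⟩⟩

end Graded

variable {G : Type*} [AddCommGroup G] [DecidableEq G]
  {𝒜 : G → Submodule Φ A} [Decomposition 𝒜] [SetLike.GradedMul 𝒜]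
  {𝒬 : G → Submodule Φ Q} [Decomposition 𝒬] [SetLike.GradedMul 𝒬]

theorem exists_homogeneous_lieIdeal (h : HasDenseDenominators ι)
    (hι : ∀ σ, ∀ a ∈ 𝒜 σ, ι a ∈ 𝒬 σ) {τ : G} {q : MinusAlgebra Q} (hq : q ∈ minusGrading 𝒬 τ) :
    ∃ (I : Submodule Φ A) (hI : IsDenseIdeal I),
      SetLike.IsHomogeneous (minusGrading 𝒜) hI.toIsTwoSidedIdeal.toLieIdeal.toSubmodule ∧
      ∀ x ∈ hI.toIsTwoSidedIdeal.toLieIdeal, ⁅minusMap ι x, q⁆ ∈ (minusMap ι).range := by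
  obtain ⟨q, hq, rfl⟩ := hq
  obtain ⟨I, hI, hI_hom, hIq⟩ := h.exists_homogeneous_dense hι hq
  refine ⟨I, hI, hI.toIsTwoSidedIdeal.isHomogeneous_toLieIdeal hI_hom, ?_⟩
  rintro _ ⟨x, hx, rfl⟩
  obtain ⟨⟨a, ha⟩, ⟨b, hb⟩⟩ := hIq x hx
  exact ⟨MinusAlgebra.of Φ (b - a), (map_sub ι b a).trans (congrArg₂ _ hb ha)⟩

variable [SemiprimeAlgebra Φ A]

theorem minusMap_mem_center (h : HasDenseDenominators ι) {x : MinusAlgebra A} :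
    minusMap ι x ∈ LieAlgebra.center Φ (MinusAlgebra Q) ↔
      x ∈ LieAlgebra.center Φ (MinusAlgebra A) :=
  MinusAlgebra.of_mem_center.trans (h.map_mem_center.trans MinusAlgebra.of_mem_center.symm)

theorem mem_center_derivedIdeal (h : HasDenseDenominators ι)
    {p : derivedIdeal Φ (MinusAlgebra Q)} :
    p ∈ LieAlgebra.center Φ (derivedIdeal Φ (MinusAlgebra Q)) ↔
      (p : MinusAlgebra Q) ∈ LieAlgebra.center Φ (MinusAlgebra Q) := by
  refine ⟨fun hp ↦ MinusAlgebra.of_mem_center.2 <|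
    h.mem_center_of_lie_lie_eq_zero isDenseIdeal_top fun x _ y _ ↦ ?_,
    fun hp z ↦ Subtype.ext (hp z)⟩
  exact congrArg Subtype.val
    (hp ⟨_, lie_mem_derivedIdeal (MinusAlgebra.of Φ (ι x)) (MinusAlgebra.of Φ (ι y))⟩)

theorem derivedMap_mem_center (h : HasDenseDenominators ι) {x : derivedIdeal Φ (MinusAlgebra A)} :
    derivedMap (minusMap ι) x ∈ LieAlgebra.center Φ (derivedIdeal Φ (MinusAlgebra Q)) ↔
      x ∈ LieAlgebra.center Φ (derivedIdeal Φ (MinusAlgebra A)) :=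
  h.mem_center_derivedIdeal.trans
    (h.minusMap_mem_center.trans (HasDenseDenominators.id Φ A).mem_center_derivedIdeal.symm)

theorem isGradedAlgebraOfQuotients_minus (h : HasDenseDenominators ι)
    (hι : ∀ σ, ∀ a ∈ 𝒜 σ, ι a ∈ 𝒬 σ) :
    IsGradedAlgebraOfQuotients (modCenterGrading (minusGrading 𝒜))
      (modCenterGrading (minusGrading 𝒬))
      (modCenterMap (minusMap ι) fun _ ↦ h.minusMap_mem_center.2) := by
  refine isGradedAlgebraOfQuotients_modCenterMap (fun _ ↦ h.minusMap_mem_center) ?_ ?_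
  · rintro σ _ ⟨a, ha, rfl⟩
    exact ⟨ι a, hι σ a ha, rfl⟩
  · intro τ q hq
    obtain ⟨I, hI, hI_hom, hIq⟩ := h.exists_homogeneous_lieIdeal hι hq
    refine ⟨_, hI_hom, hIq, fun p hp ↦ MinusAlgebra.of_mem_center.2 ?_⟩
    exact h.mem_center_of_lie_mem_center hI fun x hx ↦
      MinusAlgebra.of_mem_center.1 (hp (MinusAlgebra.of Φ x) ⟨x, hx, rfl⟩)

theorem isGradedAlgebraOfQuotients_derived (h : HasDenseDenominators ι)
    (hA : ∀ a : A, a + a = 0 → a = 0) (hι : ∀ σ, ∀ a ∈ 𝒜 σ, ι a ∈ 𝒬 σ) :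
    IsGradedAlgebraOfQuotients (modCenterGrading (derivedGrading (minusGrading 𝒜)))
      (modCenterGrading (derivedGrading (minusGrading 𝒬)))
      (modCenterMap (derivedMap (minusMap ι)) fun _ ↦ h.derivedMap_mem_center.2) := by
  refine isGradedAlgebraOfQuotients_modCenterMap (fun _ ↦ h.derivedMap_mem_center) ?_ ?_
  · rintro σ ⟨_, _⟩ ⟨a, ha, rfl⟩
    exact ⟨ι a, hι σ a ha, rfl⟩
  · intro τ q hq
    obtain ⟨I, hI, hI_hom, hIq⟩ := h.exists_homogeneous_lieIdeal hι hq
    set K := hI.toIsTwoSidedIdeal.toLieIdeal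
    refine ⟨LieIdeal.comap (derivedIdeal Φ (MinusAlgebra A)).incl ⁅K, K⁆,
      isHomogeneous_comap (𝓜 := minusGrading 𝒜) (e := _root_.id) Function.injective_id
        (fun σ x hx ↦ hx) (isHomogeneous_lie hI_hom hI_hom), fun x hx ↦ ?_, fun p hp ↦ ?_⟩
    · obtain ⟨y, hy, hyx⟩ := exists_mem_derivedIdeal_map_eq_lie hIq hx
      exact ⟨⟨y, hy⟩, Subtype.ext hyx⟩
    · refine h.mem_center_derivedIdeal.2 (MinusAlgebra.of_mem_center.2 ?_)
      refine h.mem_center_of_lie_lie_mem_center hA hI fun x hx y hy ↦ ?_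
      rw [← map_commutator]
      exact MinusAlgebra.of_mem_center.1 <| h.mem_center_derivedIdeal.1 <|
        hp ⟨_, lie_mem_derivedIdeal (MinusAlgebra.of Φ x) (MinusAlgebra.of Φ y)⟩
          (LieSubmodule.lie_mem_lie ⟨x, hx, rfl⟩ ⟨y, hy, rfl⟩)

end HasDenseDenominators

theorem mainTheorem8 {Φ : Type*} [CommRing Φ] {G : Type*} [AddCommGroup G] [DecidableEq G]
    {A : Type*} [NonUnitalRing A] [Module Φ A] [IsScalarTower Φ A A] [SMulCommClass Φ A A]
    [SemiprimeAlgebra Φ A]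
    -- the grading of `A`
    (𝒜 : G → Submodule Φ A) (h𝒜 : DirectSum.IsInternal 𝒜) (h𝒜_mul : SetLike.GradedMul 𝒜)
    -- a subalgebra `Q` of `Q_s(A)` containing `A`, with a grading extending that of `A`
    (Q : NonUnitalSubalgebra Φ (SymmetricQuotients Φ A))
    (hAQ : ∀ a : A, SymmetricQuotients.incl Φ A a ∈ Q)
    (𝒬 : G → Submodule Φ Q) (h𝒬 : DirectSum.IsInternal 𝒬) (h𝒬_mul : SetLike.GradedMul 𝒬)
    (hA𝒬 : ∀ σ, ∀ a ∈ 𝒜 σ, (⟨SymmetricQuotients.incl Φ A a, hAQ a⟩ : Q) ∈ 𝒬 σ) :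
    (∃ f : ModCenter Φ (MinusAlgebra A) →ₗ⁅Φ⁆ ModCenter Φ (MinusAlgebra Q),
      (∀ a : A, f (toModCenter Φ _ (MinusAlgebra.of Φ a)) =
        toModCenter Φ _ (MinusAlgebra.of Φ (⟨SymmetricQuotients.incl Φ A a, hAQ a⟩ : Q))) ∧
      IsGradedAlgebraOfQuotients (modCenterGrading (minusGrading 𝒜))
        (modCenterGrading (minusGrading 𝒬)) f) ∧
    ((∀ a : A, a + a = 0 → a = 0) →
      ∃ f : ModCenter Φ (derivedIdeal Φ (MinusAlgebra A)) →ₗ⁅Φ⁆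
          ModCenter Φ (derivedIdeal Φ (MinusAlgebra Q)),
        (∀ (x : derivedIdeal Φ (MinusAlgebra A)) (a : A), MinusAlgebra.of Φ a = x →
          ∃ y : derivedIdeal Φ (MinusAlgebra Q),
            (y : MinusAlgebra Q) =
              MinusAlgebra.of Φ (⟨SymmetricQuotients.incl Φ A a, hAQ a⟩ : Q) ∧
            f (toModCenter Φ _ x) = toModCenter Φ _ y) ∧
        IsGradedAlgebraOfQuotients (modCenterGrading (derivedGrading (minusGrading 𝒜)))
          (modCenterGrading (derivedGrading (minusGrading 𝒬))) f) := by
  let := h𝒜.chooseDecomposition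
  let := h𝒬.chooseDecomposition
  let ι := NonUnitalAlgHom.codRestrict (SymmetricQuotients.incl Φ A) Q hAQ
  have h : HasDenseDenominators ι := SymmetricQuotients.hasDenseDenominators Q hAQ
  refine ⟨⟨_, fun _ ↦ rfl, h.isGradedAlgebraOfQuotients_minus hA𝒬⟩, fun hA ↦
    ⟨_, fun x a hxa ↦ ⟨derivedMap (minusMap ι) x, ?_, rfl⟩,
      h.isGradedAlgebraOfQuotients_derived hA hA𝒬⟩⟩
  exact congrArg (minusMap ι) hxa.symm
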